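/- Let $M$ be a $W^*$-algebra and let $E$ be a $W^*$-correspondence over $M$, i.e. a self-dual right Hilbert $C^*$-module over $M$ with a unital normal $*$-homomorphism $\varphi : M \to \mathcal{L}(E)$ into its adjointable operators. Let $\sigma : M \to B(H)$ be a normal unital $*$-representation on a Hilbert space $H$. Let $E\otimes_\sigma H$ be the Hilbert space tensor product with $\langle \xi\otimes h, \zeta\otimes k\rangle = \langle h, \sigma(\langle \xi,\zeta\rangle)k\rangle$, on which $M$ acts by $\varphi(\cdot)\otimes I_H$; let $E^{\otimes n}\otimes_\sigma H$ be its $n$-fold iterate (for $n=0$ it is $H$, identified with $M\otimes_\sigma H$), and let $\mathcal{F}(E)\otimes_\sigma H=\bigoplus_{n\ge 0}E^{\otimes n}\otimes_\sigma H$. Write $I_k$ for the identity of $E^{\otimes k}$. Let $\mathbb{D}(E^\sigma)$ be the set of bounded operators $\eta : H \to E\otimes_\sigma H$ with $\|\eta\|<1$ and $\eta\,\sigma(a) = (\varphi(a)\otimes I_H)\,\eta$ for all $a\in M$. For $\eta\in\mathbb{D}(E^\sigma)$ put $$\eta^{(0)}=I_H,\qquad \eta^{(n+1)}=(I_{n}\otimes\eta)\,\eta^{(n)}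 : H\to E^{\otimes (n+1)}\otimes_\sigma H,$$ $$\Delta_*=(I_H-\eta^*\eta)^{1/2},\qquad \Delta=(I_{E\otimes H}-\eta\eta^*)^{1/2},$$ and let $\mathcal{D}_*=H$ and $\mathcal{D}=E\otimes_\sigma H$ be the ranges of $\Delta_*$ and $\Delta$ (both operators are invertible because $\|\eta\|<1$). The Poisson kernel $K(\eta): H\to\mathcal{F}(E)\otimes_\sigma H$ is $$K(\eta)h=\big((I_n\otimes\Delta_*)\,\eta^{(n)}h\big)_{n\ge 0}.$$ The characteristic operator $\Theta_\eta:\mathcal{F}(E)\otimes_{\varphi\otimes I}\mathcal{D}\to\mathcal{F}(E)\otimes_\sigma\mathcal{D}_*$ is the bounded operator determined by $\Theta_\eta(\xi\otimes d)=\xi\otimes\theta_\eta d$ for $\xi\in\mathcal{F}(E)$ and $d\in\mathcal{D}$, where $$\theta_\eta d=-\eta^*d+\sum_{k=1}^{\infty}(I_k\otimes\Delta_*)(I_1\otimes\eta^{(k-1)})\Delta d\in\mathcal{F}(E)\otimes_\sigma\mathcal{D}_*,$$ the $k$-th summand lying in $E^{\otimes k}\otimes_\sigma\mathcal{D}_*$.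 Theorem. For every $\eta\in\mathbb{D}(E^\sigma)$, $$I=K(\eta)K(\eta)^*+\Theta_\eta\Theta_\eta^*\qquad\text{on }\mathcal{F}(E)\otimes_\sigma\mathcal{D}_*.$$ -/

import Mathlib

universe u v

noncomputable section
open scoped TensorProduct InnerProductSpace InnerProduct
namespace WStarCorr

/-- A `W*`-correspondence `E` over `M`: a right Hilbert `C*`-module over `M` (complete, with
`M`-valued inner product `ip`, conjugate-linear in the first variable, inducing the norm of `E`)
that is self-dual, with a unital normal `*`-homomorphism `act` (the left action `φ`) from `M` into
the algebra of adjointable operators of `E`. The right action is written `MulOpposite.op a • x`.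
Mathlib's `CStarModule` is not used: its scalars act through `inner x (a • y) = a * inner x y`. -/
structure WStarCorrespondence (M : Type v) [CStarAlgebra M] [PartialOrder M] [StarOrderedRing M]
    (E : Type u) [NormedAddCommGroup E] [NormedSpace ℂ E] [CompleteSpace E]
    [Module Mᵐᵒᵖ E] where
  /-- The `M`-valued inner product. -/
  ip : E → E → M
  ip_add_right : ∀ x y z, ip x (y + z) = ip x y + ip x z
  ip_smul_right : ∀ (c : ℂ) (x y), ip x (c • y) = c • ip x y
  ip_right_act : ∀ x y (a : M), ip x (MulOpposite.op a • y) = ip x y * a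
  star_ip : ∀ x y, star (ip x y) = ip y x
  ip_self_nonneg : ∀ x, 0 ≤ ip x x
  norm_sq_eq : ∀ x, ‖x‖ ^ 2 = ‖ip x x‖
  /-- Self-duality: every bounded module map `E → M` is `⟨y, ·⟩` for some `y`. -/
  self_dual : ∀ f : E →L[ℂ] M, (∀ x (a : M), f (MulOpposite.op a • x) = f x * a) →
    ∃ y, ∀ x, f x = ip y x
  /-- The left action `φ`, a unital homomorphism. -/
  act : M →ₐ[ℂ] (E →L[ℂ] E)
  /-- `φ(a)` is adjointable with adjoint `φ(a*)`. -/
  ip_act : ∀ (a : M) x y, ip (act a x) y = ip x (act (star a) y)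
  act_right_act : ∀ (a b : M) x,
    act a (MulOpposite.op b • x) = MulOpposite.op b • act a x
  /-- Normality: `φ` preserves suprema of upward directed sets of self-adjoint elements; the order
  of self-adjoint operators on `E` is `S ≤ T ↔ ∀ x, 0 ≤ ⟨x, (T - S) x⟩`. (`φ` is monotone, so only
  the minimality of `φ(a)` among the upper bounds has to be required.) -/
  act_normal : ∀ (S : Set M) (a : M), S.Nonempty → DirectedOn (· ≤ ·) S →
    (∀ s ∈ S, IsSelfAdjoint s) → IsLUB S a →
    ∀ T : E →L[ℂ] E, (∀ x (b : M), T (MulOpposite.op b • x) = MulOpposite.op b • T x) →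
      (∀ s ∈ S, ∀ x, 0 ≤ ip x (T x - act s x)) → ∀ x, 0 ≤ ip x (T x - act a x)

section Gram
variable {M : Type v} [CStarAlgebra M] [PartialOrder M] [StarOrderedRing M]

/-- Used to show that Gram matrices in a `C*`-algebra are positive. -/
theorem selfAdjoint_negative_part {B : Type*} [CStarAlgebra B] (G : B) (hG : IsSelfAdjoint G) :
    ∃ N R : B, star R * R = -(star N * G * N) ∧ (R = 0 → ∃ C : B, star C * C = G) := by
  set N : B := cfc (fun x : ℝ => max (-x) 0) G with hN
  set R : B := cfc (fun x : ℝ => (√(max (-x) 0)) ^ 3) G with hR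
  have hNsa : star N = N := (cfc_predicate (R := ℝ) _ G : IsSelfAdjoint _).star_eq
  have hRsa : star R = R := (cfc_predicate (R := ℝ) _ G : IsSelfAdjoint _).star_eq
  refine ⟨N, R, ?_, fun hR0 => ?_⟩
  · rw [hNsa, hRsa]
    conv_rhs => enter [1, 1, 2]; rw [← cfc_id' ℝ G]
    rw [hN, hR, ← cfc_mul .., ← cfc_mul .., ← cfc_mul .., ← cfc_neg]
    congr 1
    ext x
    rcases le_total x 0 with h | h
    · have h' : max (-x) 0 = -x := max_eq_left (by linarith)
      rw [h']
      have := Real.sq_sqrt (show 0 ≤ -x by linarith)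
      calc √(-x) ^ 3 * √(-x) ^ 3 = (√(-x) ^ 2) ^ 3 := by ring
        _ = _ := by rw [this]; ring
    · have h' : max (-x) 0 = 0 := max_eq_right (by linarith)
      rw [h']; simp
  · have hspec : ∀ x ∈ spectrum ℝ G, 0 ≤ x := by
      have h0 : cfc (fun x : ℝ => (√(max (-x) 0)) ^ 3) G = cfc (fun _ : ℝ => (0 : ℝ)) G := by
        rw [← hR, hR0]; simp
      have := (cfc_eq_cfc_iff_eqOn (R := ℝ) (a := G)).1 h0
      intro x hx
      have hx0 := this hx
      simp only at hx0
      have h2 : √(max (-x) 0) = 0 := by simpa using hx0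
      have h3 := (Real.sqrt_eq_zero (le_max_right _ _)).1 h2
      have := le_max_left (-x) 0
      linarith
    refine ⟨cfc (fun x : ℝ => √x) G, ?_⟩
    rw [(cfc_predicate (R := ℝ) _ G : IsSelfAdjoint _).star_eq, ← cfc_mul ..]
    conv_rhs => rw [← cfc_id' ℝ G]
    exact cfc_congr fun x hx => Real.mul_self_sqrt (hspec x hx)

/-- A self-adjoint matrix over `M` with nonnegative quadratic form is of the form `B* B`. -/
theorem gram_factor {n : ℕ} (G : CStarMatrix (Fin n) (Fin n) M) (hG : IsSelfAdjoint G)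
    (hpos : ∀ c : Fin n → M, 0 ≤ ∑ i, ∑ j, star (c i) * G i j * c j) :
    ∃ B : CStarMatrix (Fin n) (Fin n) M, ∀ i j, G i j = ∑ k, star (B k i) * B k j := by
  obtain ⟨N, R, key, hC⟩ := selfAdjoint_negative_part G hG
  have hR0 : R = 0 := by
    ext i k
    have h1 : (star R * R) k k = (-(star N * G * N)) k k :=
      congrArg (fun A : CStarMatrix (Fin n) (Fin n) M => A k k) key
    have h2 : (star R * R) k k = ∑ i, star (R i k) * R i k := by
      rw [CStarMatrix.mul_apply]; rfl
    have h3 : (star N * G * N) k k = ∑ i, ∑ j, star (N i k) * G i j * N j k := by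
      rw [CStarMatrix.mul_apply, Finset.sum_comm]
      refine Finset.sum_congr rfl fun j _ => ?_
      rw [CStarMatrix.mul_apply, Finset.sum_mul]
      rfl
    have h4 : ∑ i, star (R i k) * R i k ≤ 0 := by
      rw [← h2, h1, CStarMatrix.neg_apply, h3]
      exact neg_nonpos.2 (hpos fun i => N i k)
    have h5 : ∑ i, star (R i k) * R i k = 0 :=
      le_antisymm h4 (Finset.sum_nonneg fun i _ => star_mul_self_nonneg _)
    have h6 := (Finset.sum_eq_zero_iff_of_nonneg (fun i _ => star_mul_self_nonneg (R i k))).1 h5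
      i (Finset.mem_univ _)
    exact CStarRing.star_mul_self_eq_zero_iff _ |>.1 h6
  obtain ⟨C, hCC⟩ := hC hR0
  refine ⟨C, fun i j => ?_⟩
  have h1 : (star C * C) i j = G i j :=
    congrArg (fun A : CStarMatrix (Fin n) (Fin n) M => A i j) hCC
  rw [← h1, CStarMatrix.mul_apply]; rfl

end Gram

/-- A Hilbert space together with a unital `*`-representation of `M` on it. -/
structure HilbertRep (M : Type v) [CStarAlgebra M] where
  carrier : Type u
  [normedAddCommGroup : NormedAddCommGroup carrier]
  [innerProductSpace : InnerProductSpace ℂ carrier]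
  [completeSpace : CompleteSpace carrier]
  rep : M →⋆ₐ[ℂ] (carrier →L[ℂ] carrier)

attribute [instance] HilbertRep.normedAddCommGroup HilbertRep.innerProductSpace
  HilbertRep.completeSpace

instance {M : Type v} [CStarAlgebra M] : CoeSort (HilbertRep.{u} M) (Type u) :=
  ⟨HilbertRep.carrier⟩

/-- A representation `σ : M → B(H)` is normal if it preserves suprema of upward directed sets of
self-adjoint elements. -/
def HilbertRep.IsNormal {M : Type v} [CStarAlgebra M] [PartialOrder M] (K : HilbertRep.{u} M) :
    Prop :=
  ∀ (S : Set M) (a : M), S.Nonempty → DirectedOn (· ≤ ·) S → (∀ s ∈ S, IsSelfAdjoint s) →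
    IsLUB S a → IsLUB (K.rep '' S) (K.rep a)

section Intertwiner
variable {M : Type v} [CStarAlgebra M]

/-- The bounded operators `T : K → L` with `T π_K(a) = π_L(a) T` for all `a ∈ M`, as a subspace of
`B(K, L)` (with the operator norm). -/
def Intertwiner (K L : HilbertRep.{u} M) : Submodule ℂ (K →L[ℂ] L) where
  carrier := {T | ∀ a, T ∘L K.rep a = L.rep a ∘L T}
  add_mem' := by
    intro S T hS hT a
    rw [ContinuousLinearMap.add_comp, ContinuousLinearMap.comp_add, hS a, hT a]
  zero_mem' := by intro a; simp
  smul_mem' := by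
    intro c T hT a
    rw [ContinuousLinearMap.smul_comp, ContinuousLinearMap.comp_smul, hT a]

variable {K L N : HilbertRep.{u} M}

theorem Intertwiner.apply_rep (T : Intertwiner K L) (a : M) (h : K) :
    T.1 (K.rep a h) = L.rep a (T.1 h) := DFunLike.congr_fun (T.2 a) h

/-- The identity operator. -/
def Intertwiner.one (K : HilbertRep.{u} M) : Intertwiner K K := ⟨1, fun _ => rfl⟩

/-- The product `S T`. -/
def Intertwiner.comp (S : Intertwiner L N) (T : Intertwiner K L) : Intertwiner K N :=
  ⟨S.1 ∘L T.1, fun a => by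
    rw [ContinuousLinearMap.comp_assoc, T.2 a, ← ContinuousLinearMap.comp_assoc, S.2 a,
      ContinuousLinearMap.comp_assoc]⟩

/-- The adjoint `T*`. -/
def Intertwiner.adj (T : Intertwiner K L) : Intertwiner L K :=
  ⟨T.1†, fun a => by
    have h := congrArg ContinuousLinearMap.adjoint (T.2 (star a))
    rw [ContinuousLinearMap.adjoint_comp, ContinuousLinearMap.adjoint_comp,
      ← ContinuousLinearMap.star_eq_adjoint, ← ContinuousLinearMap.star_eq_adjoint,
      ← map_star, ← map_star, star_star] at h
    exact h.symm⟩

/-- The positive square root `(I - T)^{1/2}`, which lies in the commutant when `T` does. -/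
def Intertwiner.sqrtOneSub (T : Intertwiner K K) : Intertwiner K K :=
  ⟨CFC.sqrt (1 - T.1), fun a => by
    have h : Commute (1 - T.1) (K.rep a) := by
      refine (Commute.one_left _).sub_left ?_
      exact T.2 a
    exact h.cfcₙ_nnreal _⟩

end Intertwiner

namespace WStarCorrespondence

variable {M : Type v} [CStarAlgebra M] [PartialOrder M] [StarOrderedRing M]
  {E : Type u} [NormedAddCommGroup E] [NormedSpace ℂ E] [CompleteSpace E] [Module Mᵐᵒᵖ E]
  (X : WStarCorrespondence M E)

theorem ip_add_left (x y z : E) : X.ip (x + y) z = X.ip x z + X.ip y z := by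
  rw [← X.star_ip, X.ip_add_right, star_add, X.star_ip, X.star_ip]

theorem ip_smul_left (c : ℂ) (x y : E) : X.ip (c • x) y = star c • X.ip x y := by
  rw [← X.star_ip, X.ip_smul_right, star_smul, X.star_ip]

theorem ip_left_act (x y : E) (a : M) :
    X.ip (MulOpposite.op a • x) y = star a * X.ip x y := by
  rw [← X.star_ip, X.ip_right_act, star_mul, X.star_ip]

theorem ip_sum_right {ι : Type*} (s : Finset ι) (x : E) (f : ι → E) :
    X.ip x (∑ i ∈ s, f i) = ∑ i ∈ s, X.ip x (f i) :=
  map_sum (AddMonoidHom.mk' (X.ip x) (X.ip_add_right x)) f s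

theorem ip_sum_left {ι : Type*} (s : Finset ι) (x : E) (f : ι → E) :
    X.ip (∑ i ∈ s, f i) x = ∑ i ∈ s, X.ip (f i) x :=
  map_sum (AddMonoidHom.mk' (fun y => X.ip y x) (fun y z => X.ip_add_left y z x)) f s

theorem ip_gram {n : ℕ} (x : Fin n → E) : ∃ B : Fin n → Fin n → M,
    ∀ i j, X.ip (x i) (x j) = ∑ k, star (B k i) * B k j := by
  obtain ⟨B, hB⟩ := gram_factor (CStarMatrix.ofMatrix fun i j => X.ip (x i) (x j))
    (by ext i j; exact X.star_ip _ _) (fun c => by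
      have h : ∑ i, ∑ j, star (c i) * X.ip (x i) (x j) * c j
          = X.ip (∑ i, MulOpposite.op (c i) • x i) (∑ i, MulOpposite.op (c i) • x i) := by
        rw [X.ip_sum_left]
        refine Finset.sum_congr rfl fun i _ => ?_
        rw [X.ip_sum_right]
        refine Finset.sum_congr rfl fun j _ => ?_
        rw [X.ip_right_act, X.ip_left_act]
      exact h ▸ X.ip_self_nonneg _)
  exact ⟨fun i j => B i j, hB⟩

variable (K L : HilbertRep.{u} M)

/-- The algebraic tensor product of `E` and `K` over `ℂ`, to be given the semi-inner product
`⟨x ⊗ h, y ⊗ k⟩ = ⟨h, π(⟨x, y⟩) k⟩`. -/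
def PreTensor (_ : WStarCorrespondence M E) (K : HilbertRep.{u} M) : Type u := E ⊗[ℂ] K

instance : AddCommGroup (X.PreTensor K) := inferInstanceAs (AddCommGroup (E ⊗[ℂ] K))
instance : Module ℂ (X.PreTensor K) := inferInstanceAs (Module ℂ (E ⊗[ℂ] K))

/-- The functional `⟨x ⊗ h, ·⟩`. -/
def preFormAux (x : E) (h : K) : X.PreTensor K →ₗ[ℂ] ℂ :=
  TensorProduct.lift (LinearMap.mk₂ ℂ (fun (y : E) (k : K) => ⟪h, K.rep (X.ip x y) k⟫_ℂ)
    (fun y z k => by simp [X.ip_add_right])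
    (fun c y k => by simp [X.ip_smul_right])
    (fun y k l => by simp)
    (fun c y k => by simp))

/-- The elementary tensor `x ⊗ h` in the algebraic tensor product. -/
def preTmul (x : E) (h : K) : X.PreTensor K := x ⊗ₜ[ℂ] h

variable {K L}

theorem preFormAux_tmul (x y : E) (h k : K) :
    X.preFormAux K x h (X.preTmul K y k) = ⟪h, K.rep (X.ip x y) k⟫_ℂ := rfl

theorem preTensor_ext {P : Type*} [AddCommGroup P] [Module ℂ P]
    {f g : X.PreTensor K →ₗ[ℂ] P} (h : ∀ x k, f (X.preTmul K x k) = g (X.preTmul K x k)) : f = g :=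
  TensorProduct.ext' (R := ℂ) (M := E) (N := K) h

variable (K) in
/-- The semi-inner product `⟨x ⊗ h, y ⊗ k⟩ = ⟨h, π(⟨x, y⟩) k⟩`. -/
def preForm : X.PreTensor K →ₗ⋆[ℂ] X.PreTensor K →ₗ[ℂ] ℂ :=
  TensorProduct.lift (LinearMap.mk₂'ₛₗ (starRingEnd ℂ) (starRingEnd ℂ)
    (fun (x : E) (h : K) => X.preFormAux K x h)
    (fun x y h => X.preTensor_ext fun z k => by simp [preFormAux_tmul, X.ip_add_left])
    (fun c x h => X.preTensor_ext fun z k => by simp [preFormAux_tmul, X.ip_smul_left])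
    (fun x h k => X.preTensor_ext fun z l => by simp [preFormAux_tmul])
    (fun c x h => X.preTensor_ext fun z l => by simp [preFormAux_tmul, mul_comm]))

theorem preForm_tmul (x y : E) (h k : K) :
    X.preForm K (X.preTmul K x h) (X.preTmul K y k) = ⟪h, K.rep (X.ip x y) k⟫_ℂ := rfl

theorem preTensor_exists_sum (z : X.PreTensor K) :
    ∃ (n : ℕ) (x : Fin n → E) (h : Fin n → K), z = ∑ i, X.preTmul K (x i) (h i) := by
  obtain ⟨n, x, h, hz⟩ := TensorProduct.exists_sum_tmul_eq (R := ℂ) (M := E) (N := K) z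
  exact ⟨n, x, h, hz⟩

theorem preForm_gram {n : ℕ} (x : Fin n → E) : ∃ B : Fin n → Fin n → M,
    ∀ (K : HilbertRep.{u} M) (h : Fin n → K),
      X.preForm K (∑ i, X.preTmul K (x i) (h i)) (∑ i, X.preTmul K (x i) (h i))
        = ((∑ k, ‖∑ i, K.rep (B k i) (h i)‖ ^ 2 : ℝ) : ℂ) := by
  obtain ⟨B, hB⟩ := X.ip_gram x
  refine ⟨B, fun K h => ?_⟩
  have h1 : ∀ k, ((‖∑ i, K.rep (B k i) (h i)‖ ^ 2 : ℝ) : ℂ)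
      = ∑ i, ∑ j, ⟪h i, K.rep (star (B k i) * B k j) (h j)⟫_ℂ := fun k => by
    have := inner_self_eq_norm_sq_to_K (𝕜 := ℂ) (∑ i, K.rep (B k i) (h i))
    rw [Complex.ofReal_pow]
    refine this.symm.trans ?_
    rw [sum_inner]
    refine Finset.sum_congr rfl fun i _ => ?_
    rw [inner_sum]
    refine Finset.sum_congr rfl fun j _ => ?_
    rw [map_mul, map_star, mul_apply_eq_comp, ContinuousLinearMap.star_eq_adjoint,
      ContinuousLinearMap.adjoint_inner_right]
  have h2 : X.preForm K (∑ i, X.preTmul K (x i) (h i)) (∑ i, X.preTmul K (x i) (h i))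
      = ∑ i, ∑ j, ⟪h i, K.rep (X.ip (x i) (x j)) (h j)⟫_ℂ := by
    simp only [map_sum, LinearMap.sum_apply, X.preForm_tmul]
    exact Finset.sum_comm
  rw [Complex.ofReal_sum, Finset.sum_congr rfl fun k _ => h1 k, h2]
  symm
  rw [Finset.sum_comm]
  refine Finset.sum_congr rfl fun i _ => ?_
  rw [Finset.sum_comm]
  refine Finset.sum_congr rfl fun j _ => ?_
  rw [hB, map_sum, sum_apply, inner_sum]

theorem preForm_conj_symm (w z : X.PreTensor K) :
    starRingEnd ℂ (X.preForm K z w) = X.preForm K w z := by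
  obtain ⟨n, x, h, rfl⟩ := X.preTensor_exists_sum w
  obtain ⟨m, y, k, rfl⟩ := X.preTensor_exists_sum z
  simp only [map_sum, LinearMap.sum_apply, X.preForm_tmul]
  rw [Finset.sum_comm]
  refine Finset.sum_congr rfl fun i _ => Finset.sum_congr rfl fun j _ => ?_
  rw [inner_conj_symm, ← ContinuousLinearMap.adjoint_inner_right,
    ← ContinuousLinearMap.star_eq_adjoint, ← map_star, X.star_ip]

variable (K) in
/-- The semi-inner product is positive semidefinite. -/
abbrev preCore : PreInnerProductSpace.Core ℂ (X.PreTensor K) where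
  inner w z := X.preForm K w z
  conj_inner_symm := X.preForm_conj_symm
  re_inner_nonneg w := by
    obtain ⟨n, x, h, rfl⟩ := X.preTensor_exists_sum w
    obtain ⟨B, hB⟩ := X.preForm_gram x
    rw [hB K h]
    exact (Finset.sum_nonneg fun _ _ => sq_nonneg _ :
      (0 : ℝ) ≤ ∑ k, ‖∑ i, K.rep (B k i) (h i)‖ ^ 2)
  add_left := LinearMap.map_add₂ _
  smul_left w z c := LinearMap.map_smulₛₗ₂ _ c w z

instance : SeminormedAddCommGroup (X.PreTensor K) :=
  InnerProductSpace.Core.toSeminormedAddCommGroup (c := X.preCore K)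
instance : InnerProductSpace ℂ (X.PreTensor K) := InnerProductSpace.ofCore (X.preCore K)

theorem preTensor_inner (w z : X.PreTensor K) : ⟪w, z⟫_ℂ = X.preForm K w z := rfl

/-- The algebraic map `I ⊗ T`. -/
def preMap (T : K →L[ℂ] L) : X.PreTensor K →ₗ[ℂ] X.PreTensor L :=
  TensorProduct.map LinearMap.id T.toLinearMap

theorem preMap_tmul (T : K →L[ℂ] L) (x : E) (h : K) :
    X.preMap T (X.preTmul K x h) = X.preTmul L x (T h) := rfl

theorem preMap_bound (T : Intertwiner K L) (z : X.PreTensor K) :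
    ‖X.preMap T.1 z‖ ≤ ‖T‖ * ‖z‖ := by
  obtain ⟨n, x, h, rfl⟩ := X.preTensor_exists_sum z
  obtain ⟨B, hB⟩ := X.preForm_gram x
  have hsq : ∀ (N : HilbertRep.{u} M) (k : Fin n → N), ‖∑ i, X.preTmul N (x i) (k i)‖ ^ 2
      = ∑ l, ‖∑ i, N.rep (B l i) (k i)‖ ^ 2 := fun N k => by
    rw [← Complex.ofReal_inj, ← hB N k, ← X.preTensor_inner, Complex.ofReal_pow]
    exact (inner_self_eq_norm_sq_to_K (𝕜 := ℂ) (∑ i, X.preTmul N (x i) (k i))).symm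
  refine le_of_sq_le_sq ?_ (by positivity)
  rw [mul_pow, map_sum, hsq K h]
  simp only [preMap_tmul]
  rw [hsq L fun i => T.1 (h i), Finset.mul_sum]
  refine Finset.sum_le_sum fun l _ => ?_
  have : ∑ i, L.rep (B l i) (T.1 (h i)) = T.1 (∑ i, K.rep (B l i) (h i)) := by
    rw [map_sum]
    exact Finset.sum_congr rfl fun i _ => (Intertwiner.apply_rep T _ _).symm
  rw [this, ← mul_pow]
  exact pow_le_pow_left₀ (norm_nonneg _) (T.1.le_opNorm _) 2

/-- The algebraic map `φ(a) ⊗ I`. -/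
def preAct (a : M) : X.PreTensor K →ₗ[ℂ] X.PreTensor K :=
  TensorProduct.map (X.act a).toLinearMap LinearMap.id

theorem preAct_tmul (a : M) (x : E) (h : K) :
    X.preAct a (X.preTmul K x h) = X.preTmul K (X.act a x) h := rfl

theorem preAct_one : (X.preAct 1 : X.PreTensor K →ₗ[ℂ] X.PreTensor K) = LinearMap.id :=
  X.preTensor_ext fun x k => by simp [preAct_tmul]

theorem preAct_mul (a b : M) :
    (X.preAct (a * b) : X.PreTensor K →ₗ[ℂ] X.PreTensor K) = X.preAct a ∘ₗ X.preAct b :=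
  X.preTensor_ext fun x k => by simp [preAct_tmul]

theorem preTmul_add_left (x y : E) (h : K) :
    X.preTmul K (x + y) h = X.preTmul K x h + X.preTmul K y h := TensorProduct.add_tmul _ _ _

theorem preTmul_smul_left (c : ℂ) (x : E) (h : K) :
    X.preTmul K (c • x) h = c • X.preTmul K x h := rfl

theorem preAct_add (a b : M) :
    (X.preAct (a + b) : X.PreTensor K →ₗ[ℂ] X.PreTensor K) = X.preAct a + X.preAct b :=
  X.preTensor_ext fun x k => by simp [preAct_tmul, preTmul_add_left]

theorem preAct_smul (c : ℂ) (a : M) :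
    (X.preAct (c • a) : X.PreTensor K →ₗ[ℂ] X.PreTensor K) = c • X.preAct a :=
  X.preTensor_ext fun x k => by simp [preAct_tmul, preTmul_smul_left]

theorem preAct_adj (a : M) (w z : X.PreTensor K) :
    ⟪X.preAct a w, z⟫_ℂ = ⟪w, X.preAct (star a) z⟫_ℂ := by
  obtain ⟨n, x, h, rfl⟩ := X.preTensor_exists_sum w
  obtain ⟨m, y, k, rfl⟩ := X.preTensor_exists_sum z
  simp only [X.preTensor_inner, map_sum, LinearMap.sum_apply, X.preForm_tmul, X.preAct_tmul,
    X.ip_act]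

theorem preAct_bound (a : M) (z : X.PreTensor K) : ‖X.preAct a z‖ ≤ ‖a‖ * ‖z‖ := by
  have h0 : 0 ≤ algebraMap ℝ M (‖a‖ ^ 2) - star a * a := by
    rw [sub_nonneg, sq, ← CStarRing.norm_star_mul_self]
    exact IsSelfAdjoint.le_algebraMap_norm_self (.star_mul_self a)
  obtain ⟨b, hb⟩ := CStarAlgebra.nonneg_iff_eq_star_mul_self.1 h0
  have h1 : ∀ c : M, ‖X.preAct c z‖ ^ 2 = (⟪z, X.preAct (star c * c) z⟫_ℂ).re := fun c => by
    rw [preAct_mul, LinearMap.comp_apply, ← preAct_adj]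
    exact (inner_self_eq_norm_sq (𝕜 := ℂ) _).symm
  have h2 : (algebraMap ℝ M (‖a‖ ^ 2)) = ((‖a‖ ^ 2 : ℝ) : ℂ) • (1 : M) := by
    rw [Algebra.algebraMap_eq_smul_one, Complex.coe_smul]
  have h3 : star a * a + star b * b = ((‖a‖ ^ 2 : ℝ) : ℂ) • (1 : M) := by
    rw [← hb, h2]; abel
  have h4 : ‖X.preAct a z‖ ^ 2 + ‖X.preAct b z‖ ^ 2 = ‖a‖ ^ 2 * ‖z‖ ^ 2 := by
    rw [h1, h1, ← Complex.add_re, ← inner_add_right, ← LinearMap.add_apply, ← preAct_add, h3,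
      preAct_smul, preAct_one, LinearMap.smul_apply, inner_smul_right, LinearMap.id_apply,
      Complex.re_ofReal_mul]
    congr 1
    exact inner_self_eq_norm_sq (𝕜 := ℂ) z
  refine le_of_sq_le_sq ?_ (by positivity)
  rw [mul_pow, ← h4]
  exact le_add_of_nonneg_right (sq_nonneg _)


open UniformSpace

/-- The operator `φ(a) ⊗ I` on the completion. -/
def tensorRepOp (K : HilbertRep.{u} M) (a : M) :
    Completion (X.PreTensor K) →L[ℂ] Completion (X.PreTensor K) :=
  ((X.preAct a).mkContinuous ‖a‖ (X.preAct_bound a)).completion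

theorem tensorRepOp_coe (a : M) (z : X.PreTensor K) :
    X.tensorRepOp K a (z : Completion (X.PreTensor K)) = (X.preAct a z : X.PreTensor K) :=
  ContinuousLinearMap.completion_apply_coe _ _

theorem completion_ext {P : Type*} [NormedAddCommGroup P] [NormedSpace ℂ P]
    {f g : Completion (X.PreTensor K) →L[ℂ] P}
    (h : ∀ z : X.PreTensor K, f z = g z) : f = g :=
  ContinuousLinearMap.ext fun z => Completion.induction_on (p := fun z => f z = g z) z
    (isClosed_eq f.continuous g.continuous) h

theorem tensorRepOp_one : X.tensorRepOp K 1 = 1 := X.completion_ext fun z => by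
  rw [tensorRepOp_coe, preAct_one]; rfl

theorem tensorRepOp_mul (a b : M) :
    X.tensorRepOp K (a * b) = X.tensorRepOp K a * X.tensorRepOp K b :=
  X.completion_ext fun z => by
    rw [mul_apply_eq_comp, tensorRepOp_coe, tensorRepOp_coe, tensorRepOp_coe, preAct_mul]; rfl

theorem tensorRepOp_add (a b : M) :
    X.tensorRepOp K (a + b) = X.tensorRepOp K a + X.tensorRepOp K b :=
  X.completion_ext fun z => by
    rw [add_apply, tensorRepOp_coe, tensorRepOp_coe, tensorRepOp_coe, preAct_add]
    exact Completion.coe_add _ _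

theorem tensorRepOp_smul (c : ℂ) (a : M) :
    X.tensorRepOp K (c • a) = c • X.tensorRepOp K a :=
  X.completion_ext fun z => by
    rw [smul_apply, tensorRepOp_coe, tensorRepOp_coe, preAct_smul]
    exact Completion.coe_smul c (X.preAct a z)

theorem tensorRepOp_star (a : M) :
    X.tensorRepOp K (star a) = star (X.tensorRepOp K a) := by
  refine (ContinuousLinearMap.eq_adjoint_iff _ _).2 fun w z => ?_
  refine Completion.induction_on₂ (p := fun w z =>
    ⟪X.tensorRepOp K (star a) w, z⟫_ℂ = ⟪w, X.tensorRepOp K a z⟫_ℂ) w z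
    (isClosed_eq (by fun_prop) (by fun_prop)) fun w z => ?_
  rw [tensorRepOp_coe, tensorRepOp_coe, Completion.inner_coe, Completion.inner_coe,
    preAct_adj, star_star]

/-- The induced representation `a ↦ φ(a) ⊗ I`. -/
def tensorRep (K : HilbertRep.{u} M) :
    M →⋆ₐ[ℂ] (Completion (X.PreTensor K) →L[ℂ] Completion (X.PreTensor K)) :=
  { AlgHom.ofLinearMap
      { toFun := X.tensorRepOp K
        map_add' := X.tensorRepOp_add
        map_smul' := X.tensorRepOp_smul } X.tensorRepOp_one X.tensorRepOp_mul with
    map_star' := X.tensorRepOp_star }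

/-- The Hilbert space `E ⊗_π K` (the Hausdorff completion of the algebraic tensor product for
`⟨x ⊗ h, y ⊗ k⟩ = ⟨h, π(⟨x, y⟩) k⟩`), with the representation `a ↦ φ(a) ⊗ I` of `M`. -/
def tensor (K : HilbertRep.{u} M) : HilbertRep.{u} M where
  carrier := Completion (X.PreTensor K)
  rep := X.tensorRep K

/-- The elementary tensor `x ⊗ h` in `E ⊗_π K`. -/
def tmul (x : E) (h : K) : X.tensor K := (X.preTmul K x h : Completion (X.PreTensor K))

theorem tmul_add_right (x : E) (h k : K) : X.tmul x (h + k) = X.tmul x h + X.tmul x k :=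
  (congrArg _ (TensorProduct.tmul_add x h k)).trans (Completion.coe_add _ _)

theorem tmul_smul_right (c : ℂ) (x : E) (h : K) : X.tmul x (c • h) = c • X.tmul x h :=
  (congrArg _ (TensorProduct.tmul_smul c x h)).trans (Completion.coe_smul c (X.preTmul K x h))

theorem tmul_zero_right (x : E) : X.tmul x (0 : K) = 0 := by
  simpa using X.tmul_smul_right 0 x (0 : K)

theorem tmul_sum_right {ι : Type*} (s : Finset ι) (x : E) (f : ι → K) :
    X.tmul x (∑ i ∈ s, f i) = ∑ i ∈ s, X.tmul x (f i) := by
  classical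
  induction s using Finset.induction_on with
  | empty => rw [Finset.sum_empty, Finset.sum_empty, X.tmul_zero_right]
  | insert i s hi ih => rw [Finset.sum_insert hi, Finset.sum_insert hi, X.tmul_add_right, ih]

theorem inner_tmul (x y : E) (h k : K) :
    ⟪X.tmul x h, X.tmul y k⟫_ℂ = ⟪h, K.rep (X.ip x y) k⟫_ℂ :=
  (Completion.inner_coe _ _).trans (X.preForm_tmul x y h k)

theorem tensor_rep_tmul (a : M) (x : E) (h : K) :
    (X.tensor K).rep a (X.tmul x h) = X.tmul (X.act a x) h :=
  X.tensorRepOp_coe a _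

theorem tensor_induction {p : X.tensor K → Prop} (hc : IsClosed {z | p z})
    (hs : ∀ (n : ℕ) (x : Fin n → E) (h : Fin n → K), p (∑ i, X.tmul (x i) (h i))) (z) : p z := by
  refine Completion.induction_on (α := X.PreTensor K) (p := p) z hc fun z => ?_
  obtain ⟨n, x, h, rfl⟩ := X.preTensor_exists_sum z
  have := hs n x h
  have h2 : ((∑ i, X.preTmul K (x i) (h i) : X.PreTensor K) : Completion (X.PreTensor K))
      = ∑ i, X.tmul (x i) (h i) :=
    map_sum (Completion.toComplₗᵢ (𝕜 := ℂ) (E := X.PreTensor K)) _ _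
  exact h2 ▸ this

theorem tensor_ext {P : Type*} [NormedAddCommGroup P] [NormedSpace ℂ P]
    {f g : X.tensor K →L[ℂ] P} (h : ∀ x k, f (X.tmul x k) = g (X.tmul x k)) : f = g := by
  ext z
  refine X.tensor_induction (p := fun z => f z = g z) (isClosed_eq f.continuous g.continuous)
    (fun n x k => ?_) z
  simp only [map_sum, h]

/-- The operator `I_E ⊗ T : E ⊗ K → E ⊗ L`. -/
def ampOp (T : Intertwiner K L) : X.tensor K →L[ℂ] X.tensor L :=
  ((X.preMap T.1).mkContinuous ‖T‖ (X.preMap_bound T)).completion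

theorem ampOp_tmul (T : Intertwiner K L) (x : E) (h : K) :
    X.ampOp T (X.tmul x h) = X.tmul x (T.1 h) :=
  ContinuousLinearMap.completion_apply_coe _ _

/-- `I_E ⊗ T`, for an intertwiner `T : K → L`; it maps `x ⊗ h` to `x ⊗ T h`. -/
def amp (T : Intertwiner K L) : Intertwiner (X.tensor K) (X.tensor L) :=
  ⟨X.ampOp T, fun a => X.tensor_ext fun x k => by
    simp [ampOp_tmul, tensor_rep_tmul]⟩

theorem amp_tmul (T : Intertwiner K L) (x : E) (h : K) :
    (X.amp T).1 (X.tmul x h) = X.tmul x (T.1 h) := X.ampOp_tmul T x h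

theorem norm_amp_le (T : Intertwiner K L) : ‖X.amp T‖ ≤ ‖T‖ := by
  refine ContinuousLinearMap.opNorm_le_bound _ (norm_nonneg _) fun z => ?_
  refine Completion.induction_on (α := X.PreTensor K) z
    (isClosed_le (by fun_prop) (by fun_prop)) fun z => ?_
  have : X.ampOp T (z : Completion (X.PreTensor K)) = ((X.preMap T.1 z : X.PreTensor L) : Completion (X.PreTensor L)) :=
    ContinuousLinearMap.completion_apply_coe _ _
  change ‖X.ampOp T (z : Completion (X.PreTensor K))‖ ≤ _
  rw [this]
  refine (Completion.norm_coe _).trans_le ?_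
  refine (X.preMap_bound T z).trans_eq ?_
  exact congrArg (‖T‖ * ·) (Completion.norm_coe z).symm

theorem norm_tmul_le (x : E) (h : K) : ‖X.tmul x h‖ ≤ ‖x‖ * ‖h‖ := by
  refine le_of_sq_le_sq ?_ (by positivity)
  have h1 : ‖X.tmul x h‖ ^ 2 = (⟪X.tmul x h, X.tmul x h⟫_ℂ).re :=
    (inner_self_eq_norm_sq (𝕜 := ℂ) _).symm
  rw [h1, inner_tmul]
  have h2 : ‖K.rep (X.ip x x)‖ ≤ ‖x‖ ^ 2 := by
    rw [X.norm_sq_eq]; exact NonUnitalStarAlgHom.norm_apply_le _ _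
  calc (⟪h, K.rep (X.ip x x) h⟫_ℂ).re ≤ ‖h‖ * ‖K.rep (X.ip x x) h‖ := re_inner_le_norm (𝕜 := ℂ) _ _
    _ ≤ ‖h‖ * (‖x‖ ^ 2 * ‖h‖) := by
        gcongr
        exact (ContinuousLinearMap.le_opNorm _ _).trans (by gcongr)
    _ = (‖x‖ * ‖h‖) ^ 2 := by ring

end WStarCorrespondence

section HilbertSum
variable {V : Type*} [NormedAddCommGroup V] [NormedSpace ℂ V]
  {F G : ℕ → Type*} [∀ n, NormedAddCommGroup (F n)] [∀ n, InnerProductSpace ℂ (F n)]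
  [∀ n, NormedAddCommGroup (G n)] [∀ n, InnerProductSpace ℂ (G n)]

set_option linter.unusedSectionVars false

theorem memlp_of_partial {g : ∀ n, G n} {C : ℝ}
    (h : ∀ N, ∑ n ∈ Finset.range N, ‖g n‖ ^ 2 ≤ C) : Memℓp g 2 := by
  refine memℓp_gen' (C := C) fun s => ?_
  obtain ⟨N, hN⟩ := s.exists_nat_subset_range
  refine le_trans ?_ (h N)
  have : ∀ n, ‖g n‖ ^ (2 : ENNReal).toReal = ‖g n‖ ^ 2 := fun n => by norm_cast
  simp only [this]
  exact Finset.sum_le_sum_of_subset_of_nonneg hN fun _ _ _ => by positivity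

theorem lp_norm_sq (g : lp G 2) : HasSum (fun n => ‖g n‖ ^ 2) (‖g‖ ^ 2) := by
  have := lp.hasSum_norm (p := 2) (by norm_num) g
  norm_cast at this

theorem lp_norm_le {g : lp G 2} {C : ℝ} (hC : 0 ≤ C)
    (h : ∀ N, ∑ n ∈ Finset.range N, ‖g n‖ ^ 2 ≤ C ^ 2) : ‖g‖ ≤ C := by
  refine le_of_sq_le_sq ?_ hC
  exact le_of_tendsto' (lp_norm_sq g).tendsto_sum_nat h

/-- The bounded operator into a Hilbert sum with given bounded coordinates. -/
def lpOp (A : V →ₗ[ℂ] ∀ n, G n) (C : ℝ) (hC : 0 ≤ C)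
    (h : ∀ x N, ∑ n ∈ Finset.range N, ‖A x n‖ ^ 2 ≤ (C * ‖x‖) ^ 2) : V →L[ℂ] lp G 2 :=
  LinearMap.mkContinuous
    { toFun := fun x => ⟨A x, memlp_of_partial (h x)⟩
      map_add' := fun x y => lp.ext (map_add A x y)
      map_smul' := fun c x => lp.ext (map_smul A c x) } C
    fun x => lp_norm_le (by positivity) (h x)

theorem lpOp_apply (A : V →ₗ[ℂ] ∀ n, G n) (C : ℝ) (hC : 0 ≤ C)
    (h : ∀ x N, ∑ n ∈ Finset.range N, ‖A x n‖ ^ 2 ≤ (C * ‖x‖) ^ 2) (x : V) (n : ℕ) :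
    lpOp A C hC h x n = A x n := rfl

theorem partial_norm_sq_le (g : lp G 2) (N : ℕ) :
    ∑ n ∈ Finset.range N, ‖g n‖ ^ 2 ≤ ‖g‖ ^ 2 :=
  sum_le_hasSum _ (fun _ _ => by positivity) (lp_norm_sq g)

/-- The column operator `x ↦ (f n x)_n`. -/
def columnOp (f : ∀ n, V →L[ℂ] G n) (c : ℕ → ℝ) (hc : Summable c) (hf : ∀ n, ‖f n‖ ≤ c n) :
    V →L[ℂ] lp G 2 :=
  lpOp (LinearMap.pi fun n => (f n).toLinearMap) (∑' n, c n)
    (tsum_nonneg fun n => (norm_nonneg _).trans (hf n)) fun x N => by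
      have hc0 : ∀ n, 0 ≤ c n := fun n => (norm_nonneg _).trans (hf n)
      have h1 : ∀ n, ‖f n x‖ ≤ c n * ‖x‖ := fun n => (f n).le_of_opNorm_le (hf n) x
      calc ∑ n ∈ Finset.range N, ‖f n x‖ ^ 2 ≤ (∑ n ∈ Finset.range N, ‖f n x‖) ^ 2 :=
            Finset.sum_sq_le_sq_sum_of_nonneg fun _ _ => norm_nonneg _
        _ ≤ ((∑' n, c n) * ‖x‖) ^ 2 := by
            refine pow_le_pow_left₀ (Finset.sum_nonneg fun _ _ => norm_nonneg _) ?_ 2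
            refine (Finset.sum_le_sum fun n _ => h1 n).trans ?_
            rw [← Finset.sum_mul]
            exact mul_le_mul_of_nonneg_right (hc.sum_le_tsum _ fun n _ => hc0 n) (norm_nonneg _)

theorem columnOp_apply (f : ∀ n, V →L[ℂ] G n) (c : ℕ → ℝ) (hc : Summable c)
    (hf : ∀ n, ‖f n‖ ≤ c n) (x : V) (n : ℕ) : columnOp f c hc hf x n = f n x := rfl

/-- The diagonal operator `(x n)_n ↦ (A n (x n))_n`. -/
def diagOp (A : ∀ n, F n →L[ℂ] G n) (C : ℝ) (hC : 0 ≤ C) (hA : ∀ n, ‖A n‖ ≤ C) :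
    lp F 2 →L[ℂ] lp G 2 :=
  lpOp { toFun := fun x n => A n (x n)
         map_add' := fun x y => by ext n; simp
         map_smul' := fun c x => by ext n; simp } C hC fun x N => by
    calc ∑ n ∈ Finset.range N, ‖A n (x n)‖ ^ 2
        ≤ ∑ n ∈ Finset.range N, C ^ 2 * ‖x n‖ ^ 2 := Finset.sum_le_sum fun n _ => by
          rw [← mul_pow]
          exact pow_le_pow_left₀ (norm_nonneg _) ((A n).le_of_opNorm_le (hA n) _) 2
      _ ≤ (C * ‖x‖) ^ 2 := by
          rw [← Finset.mul_sum, mul_pow]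
          exact mul_le_mul_of_nonneg_left (partial_norm_sq_le x N) (by positivity)

theorem diagOp_apply (A : ∀ n, F n →L[ℂ] G n) (C : ℝ) (hC : 0 ≤ C) (hA : ∀ n, ‖A n‖ ≤ C)
    (x : lp F 2) (n : ℕ) : diagOp A C hC hA x n = A n (x n) := rfl

theorem young_partial (c a : ℕ → ℝ) (hc : Summable c) (hc0 : ∀ n, 0 ≤ c n) (N : ℕ) :
    ∑ i ∈ Finset.range N, (∑ j ∈ Finset.range (i + 1), c (i - j) * a j) ^ 2
      ≤ (∑' n, c n) ^ 2 * ∑ j ∈ Finset.range N, a j ^ 2 := by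
  have hC : 0 ≤ ∑' n, c n := tsum_nonneg hc0
  have h1 : ∀ i, (∑ j ∈ Finset.range (i + 1), c (i - j) * a j) ^ 2
      ≤ (∑' n, c n) * ∑ j ∈ Finset.range (i + 1), c (i - j) * a j ^ 2 := fun i => by
    refine (Finset.sum_sq_le_sum_mul_sum_of_sq_le_mul _ (f := fun j => c (i - j))
      (g := fun j => c (i - j) * a j ^ 2) (fun j _ => hc0 _)
      (fun j _ => mul_nonneg (hc0 _) (sq_nonneg _)) (fun j _ => by ring_nf; exact le_rfl)).trans ?_
    refine mul_le_mul_of_nonneg_right ?_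
      (Finset.sum_nonneg fun j _ => mul_nonneg (hc0 _) (sq_nonneg _))
    have := Finset.sum_range_reflect c (i + 1)
    simp only [Nat.add_sub_cancel] at this
    rw [this]
    exact hc.sum_le_tsum _ fun n _ => hc0 n
  refine (Finset.sum_le_sum fun i _ => h1 i).trans ?_
  rw [← Finset.mul_sum, sq, mul_assoc]
  refine mul_le_mul_of_nonneg_left ?_ hC
  have h2 : ∑ i ∈ Finset.range N, ∑ j ∈ Finset.range (i + 1), c (i - j) * a j ^ 2
      = ∑ j ∈ Finset.range N, ∑ i ∈ Finset.Ico j N, c (i - j) * a j ^ 2 := by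
    refine Finset.sum_comm' fun i j => ?_
    simp only [Finset.mem_range, Finset.mem_Ico]
    omega
  rw [h2, Finset.mul_sum]
  refine Finset.sum_le_sum fun j _ => ?_
  rw [← Finset.sum_mul]
  refine mul_le_mul_of_nonneg_right ?_ (sq_nonneg _)
  rw [Finset.sum_Ico_eq_sum_range]
  simp only [Nat.add_sub_cancel_left]
  exact hc.sum_le_tsum _ fun n _ => hc0 n

/-- The operator between Hilbert sums with lower triangular matrix `(A i j)_{j ≤ i}`. -/
def lowerOp (A : ∀ i j, F j →L[ℂ] G i) (c : ℕ → ℝ) (hc : Summable c) (hc0 : ∀ n, 0 ≤ c n)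
    (hA : ∀ i j, j ≤ i → ‖A i j‖ ≤ c (i - j)) : lp F 2 →L[ℂ] lp G 2 :=
  lpOp { toFun := fun x i => ∑ j ∈ Finset.range (i + 1), A i j (x j)
         map_add' := fun x y => by ext n; simp [Finset.sum_add_distrib]
         map_smul' := fun c x => by ext n; simp [Finset.smul_sum] }
    (∑' n, c n) (tsum_nonneg hc0) fun x N => by
    calc ∑ i ∈ Finset.range N, ‖∑ j ∈ Finset.range (i + 1), A i j (x j)‖ ^ 2
        ≤ ∑ i ∈ Finset.range N, (∑ j ∈ Finset.range (i + 1), c (i - j) * ‖x j‖) ^ 2 := by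
          refine Finset.sum_le_sum fun i _ => pow_le_pow_left₀ (norm_nonneg _) ?_ 2
          refine (norm_sum_le _ _).trans (Finset.sum_le_sum fun j hj => ?_)
          exact (A i j).le_of_opNorm_le (hA i j (Nat.lt_succ_iff.1 (Finset.mem_range.1 hj))) _
      _ ≤ (∑' n, c n) ^ 2 * ∑ j ∈ Finset.range N, ‖x j‖ ^ 2 := young_partial _ _ hc hc0 N
      _ ≤ ((∑' n, c n) * ‖x‖) ^ 2 := by
          rw [mul_pow]
          exact mul_le_mul_of_nonneg_left (partial_norm_sq_le x N) (by positivity)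

theorem lowerOp_apply (A : ∀ i j, F j →L[ℂ] G i) (c : ℕ → ℝ) (hc : Summable c)
    (hc0 : ∀ n, 0 ≤ c n) (hA : ∀ i j, j ≤ i → ‖A i j‖ ≤ c (i - j)) (x : lp F 2) (i : ℕ) :
    lowerOp A c hc hc0 hA x i = ∑ j ∈ Finset.range (i + 1), A i j (x j) := rfl

end HilbertSum

theorem Intertwiner.norm_comp_le {M : Type v} [CStarAlgebra M] {K L N : HilbertRep.{u} M}
    (S : Intertwiner L N) (T : Intertwiner K L) : ‖Intertwiner.comp S T‖ ≤ ‖S‖ * ‖T‖ :=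
  ContinuousLinearMap.opNorm_comp_le S.1 T.1

theorem Intertwiner.norm_adj {M : Type v} [CStarAlgebra M] {K L : HilbertRep.{u} M}
    (T : Intertwiner K L) : ‖Intertwiner.adj T‖ = ‖T‖ :=
  LinearIsometryEquiv.norm_map ContinuousLinearMap.adjoint T.1

namespace WStarCorrespondence

variable {M : Type v} [CStarAlgebra M] [PartialOrder M] [StarOrderedRing M]
  {E : Type u} [NormedAddCommGroup E] [NormedSpace ℂ E] [CompleteSpace E] [Module Mᵐᵒᵖ E]
  (X : WStarCorrespondence M E) {K L H : HilbertRep.{u} M}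

/-- The Hilbert space `E^{⊗n} ⊗_π K`, as `E ⊗ (E ⊗ ⋯ (E ⊗ K))`, with the representation
`φ_n ⊗ I` of `M`; for `n = 0` it is `M ⊗_π K = K`, with `π`. -/
def tensorPow (K : HilbertRep.{u} M) : ℕ → HilbertRep.{u} M
  | 0 => K
  | n + 1 => X.tensor (tensorPow K n)

/-- The Hilbert space `𝓕(E) ⊗_π K = ⨁ₙ E^{⊗n} ⊗_π K`. -/
abbrev Fock (K : HilbertRep.{u} M) : Type u := lp (fun n => (X.tensorPow K n : Type u)) 2

/-- The component in `E^{⊗n} ⊗_π K`. -/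
def coord (x : X.Fock K) (n : ℕ) : X.tensorPow K n := x n

variable {X} in
theorem fock_ext {x y : X.Fock K} (h : ∀ n, X.coord x n = X.coord y n) : x = y :=
  lp.ext (funext h)

/-- `I_k ⊗ T : E^{⊗k} ⊗ K → E^{⊗k} ⊗ L`. -/
def ampPow (T : Intertwiner K L) : ∀ k, Intertwiner (X.tensorPow K k) (X.tensorPow L k)
  | 0 => T
  | k + 1 => X.amp (ampPow T k)

theorem norm_ampPow_le (T : Intertwiner K L) : ∀ k, ‖X.ampPow T k‖ ≤ ‖T‖
  | 0 => le_rfl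
  | k + 1 => (X.norm_amp_le _).trans (norm_ampPow_le T k)

/-- `I_{𝓕(E)} ⊗ T : 𝓕(E) ⊗ K → 𝓕(E) ⊗ L`. -/
def fockMap (T : Intertwiner K L) : X.Fock K →L[ℂ] X.Fock L :=
  diagOp (fun n => (X.ampPow T n).1) ‖T‖ (norm_nonneg _) (X.norm_ampPow_le T)

/-- The `σ`-dual `E^σ`: the bounded operators `η : H → E ⊗_σ H` with
`η σ(a) = (φ(a) ⊗ I) η` for all `a ∈ M`. -/
abbrev SigmaDual (H : HilbertRep.{u} M) : Submodule ℂ (H →L[ℂ] X.tensor H) :=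
  Intertwiner H (X.tensor H)


/-- `I_{E^{⊗k}} ⊗ η : E^{⊗k} ⊗ H → E^{⊗(k+1)} ⊗ H`. -/
def ampDual (η : X.SigmaDual H) : ∀ k, Intertwiner (X.tensorPow H k) (X.tensorPow H (k + 1))
  | 0 => η
  | k + 1 => X.amp (ampDual η k)

theorem norm_ampDual_le (η : X.SigmaDual H) : ∀ k, ‖X.ampDual η k‖ ≤ ‖η‖
  | 0 => le_rfl
  | k + 1 => (X.norm_amp_le _).trans (norm_ampDual_le η k)

/-- `η^{(n)} : H → E^{⊗n} ⊗ H`, with `η^{(0)} = I` and `η^{(n+1)} = (I_{E^{⊗n}} ⊗ η) η^{(n)}`. -/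
def dualPow (η : X.SigmaDual H) : ∀ n, Intertwiner H (X.tensorPow H n)
  | 0 => Intertwiner.one H
  | n + 1 => Intertwiner.comp (X.ampDual η n) (dualPow η n)

theorem norm_dualPow_le (η : X.SigmaDual H) : ∀ n, ‖X.dualPow η n‖ ≤ ‖η‖ ^ n
  | 0 => by
    rw [pow_zero]
    exact ContinuousLinearMap.norm_id_le
  | n + 1 => by
    rw [pow_succ, mul_comm]
    exact (Intertwiner.norm_comp_le _ _).trans
      (mul_le_mul (X.norm_ampDual_le η n) (norm_dualPow_le η n) (norm_nonneg _) (norm_nonneg _))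

/-- The Cauchy kernel `C(η) = [η^{(0)}, η^{(1)}, η^{(2)}, …]ᵀ`. -/
def cauchyKernel (η : X.SigmaDual H) (hη : ‖η‖ < 1) : H →L[ℂ] X.Fock H :=
  columnOp (fun n => (X.dualPow η n).1) (fun n => ‖η‖ ^ n)
    (summable_geometric_of_lt_one (norm_nonneg _) hη) (X.norm_dualPow_le η)

/-- `Δ_* = (I_H - η* η)^{1/2}`. -/
def defectStar (η : X.SigmaDual H) : Intertwiner H H :=
  Intertwiner.sqrtOneSub (Intertwiner.comp (Intertwiner.adj η) η)

/-- `Δ = (I_{E ⊗ H} - η η*)^{1/2}`. -/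
def defect (η : X.SigmaDual H) : Intertwiner (X.tensor H) (X.tensor H) :=
  Intertwiner.sqrtOneSub (Intertwiner.comp η (Intertwiner.adj η))

/-- The Poisson kernel `K(η) = (I_{𝓕(E)} ⊗ Δ_*) C(η)`. -/
def poissonKernel (η : X.SigmaDual H) (hη : ‖η‖ < 1) : H →L[ℂ] X.Fock H :=
  X.fockMap (X.defectStar η) ∘L X.cauchyKernel η hη

theorem poissonKernel_apply (η : X.SigmaDual H) (hη : ‖η‖ < 1) (h : H) (n : ℕ) :
    X.coord (X.poissonKernel η hη h) n = (X.ampPow (X.defectStar η) n).1 ((X.dualPow η n).1 h) := rfl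

/-- The components of `θ_η`: `θ_0 = -η*` and `θ_{k+1} = (I_{k+1} ⊗ Δ_*) (I_1 ⊗ η^{(k)}) Δ`, a map
`E ⊗ H → E^{⊗(k+1)} ⊗ H`. Since `‖η‖ < 1`, the ranges `𝒟` of `Δ` and `𝒟_*` of `Δ_*` are all of
`E ⊗ H` and `H` (see `defect_surjective` and `defectStar_surjective`). -/
def theta (η : X.SigmaDual H) : ∀ k, Intertwiner (X.tensor H) (X.tensorPow H k)
  | 0 => -Intertwiner.adj η
  | k + 1 => Intertwiner.comp (X.ampPow (X.defectStar η) (k + 1))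
      (Intertwiner.comp (X.amp (X.dualPow η k)) (X.defect η))

/-- A summable bound for the norms of the components of `θ_η`. -/
def thetaBound (η : X.SigmaDual H) : ℕ → ℝ
  | 0 => ‖η‖
  | k + 1 => ‖X.defectStar η‖ * (‖η‖ ^ k * ‖X.defect η‖)

theorem thetaBound_nonneg (η : X.SigmaDual H) : ∀ k, 0 ≤ X.thetaBound η k
  | 0 => norm_nonneg _
  | _ + 1 => by unfold thetaBound; positivity

theorem summable_thetaBound (η : X.SigmaDual H) (hη : ‖η‖ < 1) : Summable (X.thetaBound η) :=
  (summable_nat_add_iff 1).1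
    (((summable_geometric_of_lt_one (norm_nonneg _) hη).mul_right _).mul_left _)

theorem norm_theta_le (η : X.SigmaDual H) : ∀ k, ‖X.theta η k‖ ≤ X.thetaBound η k
  | 0 => by
    change ‖-Intertwiner.adj η‖ ≤ ‖η‖
    exact (norm_neg (Intertwiner.adj η).1).trans_le (Intertwiner.norm_adj η).le
  | k + 1 => by
    refine (Intertwiner.norm_comp_le _ _).trans ?_
    refine mul_le_mul (X.norm_ampPow_le _ _) ?_ (norm_nonneg _) (norm_nonneg _)
    refine (Intertwiner.norm_comp_le _ _).trans ?_
    exact mul_le_mul_of_nonneg_right ((X.norm_amp_le _).trans (X.norm_dualPow_le η k)) (norm_nonneg _)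

/-- The operator `θ_η : 𝒟 → 𝓕(E) ⊗ 𝒟_*`,
`θ_η d = -η* d + ∑_{k ≥ 1} (I_k ⊗ Δ_*) (I_1 ⊗ η^{(k-1)}) Δ d`. -/
def thetaOp (η : X.SigmaDual H) (hη : ‖η‖ < 1) : X.tensor H →L[ℂ] X.Fock H :=
  columnOp (fun k => (X.theta η k).1) (X.thetaBound η) (X.summable_thetaBound η hη) (X.norm_theta_le η)

/-- The matrix entries `E^{⊗j} ⊗ 𝒟 → E^{⊗i} ⊗ 𝒟_*` of the characteristic operator: `I_j ⊗ θ_{i-j}`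
for `j ≤ i`, and `0` for `i < j`. -/
def entry (η : X.SigmaDual H) : ∀ i j, Intertwiner (X.tensorPow (X.tensor H) j) (X.tensorPow H i)
  | i, 0 => X.theta η i
  | 0, _ + 1 => 0
  | i + 1, j + 1 => X.amp (entry η i j)

theorem norm_entry_le (η : X.SigmaDual H) : ∀ i j, j ≤ i → ‖X.entry η i j‖ ≤ X.thetaBound η (i - j)
  | i, 0, _ => by
    cases i <;> exact X.norm_theta_le η _
  | 0, _ + 1, h => by omega
  | i + 1, j + 1, h => by
    rw [Nat.add_sub_add_right]
    exact (X.norm_amp_le _).trans (norm_entry_le η i j (by omega))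

/-- The characteristic operator `Θ_η : 𝓕(E) ⊗ 𝒟 → 𝓕(E) ⊗ 𝒟_*`, `Θ_η (ξ ⊗ d) = ξ ⊗ θ_η d`.
By `characteristicOperator_vacuum`, `characteristicOperator_creation` and
`characteristicOperator_unique` it is the unique bounded operator that restricts to `θ_η` on `𝒟`
and satisfies `Θ_η (ξ ⊗ x) = ξ ⊗ Θ_η x` for `ξ ∈ E`. -/
def characteristicOperator (η : X.SigmaDual H) (hη : ‖η‖ < 1) :
    X.Fock (X.tensor H) →L[ℂ] X.Fock H :=
  lowerOp (fun i j => (X.entry η i j).1) (X.thetaBound η) (X.summable_thetaBound η hη)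
    (X.thetaBound_nonneg η) (X.norm_entry_le η)



theorem thetaOp_coord (η : X.SigmaDual H) (hη : ‖η‖ < 1) (d : X.tensor H) (i : ℕ) :
    X.coord (X.thetaOp η hη d) i = (X.theta η i).1 d := rfl

theorem entry_zero (η : X.SigmaDual H) (i : ℕ) : X.entry η i 0 = X.theta η i := by
  cases i <;> rfl

theorem characteristicOperator_coord (η : X.SigmaDual H) (hη : ‖η‖ < 1)
    (x : X.Fock (X.tensor H)) (i : ℕ) : X.coord (X.characteristicOperator η hη x) i
      = ∑ j ∈ Finset.range (i + 1), (X.entry η i j).1 (X.coord x j) := rfl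

/-- The creation operator `T_ξ ⊗ I`, `x ↦ ξ ⊗ x`. -/
def creation (ξ : E) : X.Fock K →L[ℂ] X.Fock K :=
  lpOp { toFun := fun x n => match n with
          | 0 => 0
          | n + 1 => X.tmul ξ (x n)
         map_add' := fun x y => by
          ext n
          cases n with
          | zero => exact (add_zero (0 : K)).symm
          | succ n => exact X.tmul_add_right ξ (x n) (y n)
         map_smul' := fun c x => by
          ext n
          cases n with
          | zero => exact (smul_zero (A := K) c).symm
          | succ n => exact X.tmul_smul_right c ξ (x n) } ‖ξ‖ (norm_nonneg _) fun x N => by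
    cases N with
    | zero => simp; positivity
    | succ N =>
      rw [Finset.sum_range_succ']
      simp only [LinearMap.coe_mk, AddHom.coe_mk, norm_zero]
      calc ∑ n ∈ Finset.range N, ‖X.tmul ξ (x n)‖ ^ 2 + 0 ^ 2
          ≤ ∑ n ∈ Finset.range N, ‖ξ‖ ^ 2 * ‖x n‖ ^ 2 := by
            rw [zero_pow two_ne_zero, add_zero]
            refine Finset.sum_le_sum fun n _ => ?_
            rw [← mul_pow]
            exact pow_le_pow_left₀ (norm_nonneg _) (X.norm_tmul_le _ _) 2
        _ ≤ (‖ξ‖ * ‖x‖) ^ 2 := by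
          rw [← Finset.mul_sum, mul_pow]
          exact mul_le_mul_of_nonneg_left (partial_norm_sq_le x N) (by positivity)

theorem creation_zero (ξ : E) (x : X.Fock K) : X.coord (X.creation ξ x) 0 = 0 := rfl

theorem creation_succ (ξ : E) (x : X.Fock K) (n : ℕ) :
    X.coord (X.creation ξ x) (n + 1) = X.tmul ξ (X.coord x n) := rfl

/-- The inclusion of `E^{⊗n} ⊗ K` as the `n`-th summand of `𝓕(E) ⊗ K`. -/
def incl (n : ℕ) : X.tensorPow K n →L[ℂ] X.Fock K :=
  lp.singleContinuousLinearMap ℂ (fun n => (X.tensorPow K n : Type u)) 2 n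

theorem incl_self (n : ℕ) (k : X.tensorPow K n) : X.coord (X.incl n k) n = k :=
  lp.single_apply_self (E := fun n => (X.tensorPow K n : Type u)) 2 n k

theorem incl_ne {n i : ℕ} (k : X.tensorPow K n) (h : i ≠ n) : X.coord (X.incl n k) i = 0 :=
  lp.single_apply_ne (E := fun n => (X.tensorPow K n : Type u)) 2 n k h

theorem hasSum_incl (x : X.Fock K) : HasSum (fun n => X.incl n (X.coord x n)) x :=
  lp.hasSum_single (p := 2) (by norm_num) x

theorem creation_incl (ξ : E) (n : ℕ) (k : X.tensorPow K n) :
    X.creation ξ (X.incl n k) = X.incl (n + 1) (X.tmul ξ k : X.tensor (X.tensorPow K n)) := by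
  refine fock_ext fun i => ?_
  cases i with
  | zero => exact (X.incl_ne _ (Nat.succ_ne_zero n).symm).symm
  | succ i =>
    rw [creation_succ]
    by_cases hin : i = n
    · subst hin
      rw [X.incl_self]
      exact (X.incl_self (i + 1) _).symm
    · rw [X.incl_ne _ hin, X.tmul_zero_right]
      exact (X.incl_ne (n := n + 1) (i := i + 1) (X.tmul ξ k : X.tensor (X.tensorPow K n))
        (by omega)).symm

theorem characteristicOperator_vacuum (η : X.SigmaDual H) (hη : ‖η‖ < 1) (d : X.tensor H) :
    X.characteristicOperator η hη (X.incl 0 d) = X.thetaOp η hη d := by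
  refine fock_ext fun i => ?_
  rw [characteristicOperator_coord, thetaOp_coord, Finset.sum_range_succ', Finset.sum_eq_zero,
    zero_add, entry_zero]
  · exact congrArg _ (X.incl_self 0 d)
  · intro j _
    exact (congrArg _ (X.incl_ne (K := X.tensor H) (n := 0) d (Nat.succ_ne_zero j))).trans (map_zero _)

theorem characteristicOperator_creation (η : X.SigmaDual H) (hη : ‖η‖ < 1) (ξ : E)
    (x : X.Fock (X.tensor H)) :
    X.characteristicOperator η hη (X.creation ξ x)
      = X.creation ξ (X.characteristicOperator η hη x) := by
  refine fock_ext fun i => ?_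
  cases i with
  | zero =>
    rw [characteristicOperator_coord, zero_add, Finset.sum_range_one, creation_zero, map_zero,
      creation_zero]
  | succ i =>
    rw [characteristicOperator_coord, creation_succ, characteristicOperator_coord,
      Finset.sum_range_succ', creation_zero, map_zero, add_zero, X.tmul_sum_right]
    exact Finset.sum_congr rfl fun j _ => X.amp_tmul (X.entry η i j) ξ (X.coord x j)

theorem characteristicOperator_unique (η : X.SigmaDual H) (hη : ‖η‖ < 1)
    (Y : X.Fock (X.tensor H) →L[ℂ] X.Fock H)
    (h0 : ∀ d : X.tensor H, Y (X.incl 0 d) = X.thetaOp η hη d)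
    (h1 : ∀ ξ x, Y (X.creation ξ x) = X.creation ξ (Y x)) :
    Y = X.characteristicOperator η hη := by
  have h : ∀ n, Y ∘L X.incl n = X.characteristicOperator η hη ∘L X.incl n := by
    intro n
    induction n with
    | zero =>
      exact ContinuousLinearMap.ext fun d =>
        (h0 d).trans (X.characteristicOperator_vacuum η hη d).symm
    | succ n ih =>
      refine X.tensor_ext (K := X.tensorPow (X.tensor H) n) fun ξ k => ?_
      change Y (X.incl (n + 1) (X.tmul ξ k : X.tensor (X.tensorPow (X.tensor H) n)))
        = X.characteristicOperator η hη
          (X.incl (n + 1) (X.tmul ξ k : X.tensor (X.tensorPow (X.tensor H) n)))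
      rw [← creation_incl, h1, characteristicOperator_creation]
      exact congrArg (X.creation ξ) (DFunLike.congr_fun ih k)
  refine ContinuousLinearMap.ext fun x => ?_
  refine ((X.hasSum_incl x).mapL Y).unique ?_
  have e2 := (X.hasSum_incl x).mapL (X.characteristicOperator η hη)
  have e3 : (fun n => Y (X.incl n (X.coord x n)))
      = fun n => X.characteristicOperator η hη (X.incl n (X.coord x n)) :=
    funext fun n => DFunLike.congr_fun (h n) (X.coord x n)
  exact e3 ▸ e2

theorem isUnit_defectStar (η : X.SigmaDual H) (hη : ‖η‖ < 1) : IsUnit (X.defectStar η).1 := by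
  have h2 : ‖η.1† ∘L η.1‖ < 1 := by
    rw [ContinuousLinearMap.norm_adjoint_comp_self]
    exact mul_lt_one_of_nonneg_of_lt_one_left (norm_nonneg _) hη hη.le
  have h1 : (η.1† ∘L η.1) ≤ 1 := by
    have := IsSelfAdjoint.le_algebraMap_norm_self (a := η.1† ∘L η.1)
      (ContinuousLinearMap.isPositive_adjoint_comp_self η.1).isSelfAdjoint
    refine this.trans ?_
    rw [← map_one (algebraMap ℝ (H →L[ℂ] H))]
    exact algebraMap_mono _ h2.le
  exact (CFC.isUnit_sqrt_iff _ (sub_nonneg.2 h1)).2 (isUnit_one_sub_of_norm_lt_one h2)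

theorem isUnit_defect (η : X.SigmaDual H) (hη : ‖η‖ < 1) : IsUnit (X.defect η).1 := by
  have h2 : ‖η.1 ∘L η.1†‖ < 1 := by
    have := ContinuousLinearMap.norm_adjoint_comp_self (η.1†)
    rw [ContinuousLinearMap.adjoint_adjoint] at this
    rw [this, LinearIsometryEquiv.norm_map]
    exact mul_lt_one_of_nonneg_of_lt_one_left (norm_nonneg _) hη hη.le
  have h1 : (η.1 ∘L η.1†) ≤ 1 := by
    have := IsSelfAdjoint.le_algebraMap_norm_self (a := η.1 ∘L η.1†)
      (ContinuousLinearMap.isPositive_self_comp_adjoint η.1).isSelfAdjoint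
    refine this.trans ?_
    rw [← map_one (algebraMap ℝ (X.tensor H →L[ℂ] X.tensor H))]
    exact algebraMap_mono _ h2.le
  exact (CFC.isUnit_sqrt_iff _ (sub_nonneg.2 h1)).2 (isUnit_one_sub_of_norm_lt_one h2)

theorem defectStar_surjective (η : X.SigmaDual H) (hη : ‖η‖ < 1) :
    Function.Surjective (X.defectStar η).1 := fun y => by
  obtain ⟨u, hu⟩ := X.isUnit_defectStar η hη
  refine ⟨(u⁻¹).1 y, ?_⟩
  rw [← hu, ← mul_apply_eq_comp, u.mul_inv]; rfl

theorem defect_surjective (η : X.SigmaDual H) (hη : ‖η‖ < 1) :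
    Function.Surjective (X.defect η).1 := fun y => by
  obtain ⟨u, hu⟩ := X.isUnit_defect η hη
  refine ⟨(u⁻¹).1 y, ?_⟩
  rw [← hu, ← mul_apply_eq_comp, u.mul_inv]; rfl

end WStarCorrespondence
end WStarCorr

end

/-! Everything rests on the 2 × 2 operator matrix on `H ⊕ (E ⊗ H)` with rows `(Δ_*, -η*)` and `(η,
Δ)`. Its rows are orthonormal: `Δ_*² + η*η = I` and `ηη* + Δ² = I` hold by definition of the defect
operators, and the cross term vanishes because `ηΔ_* = Δη` (`comp_defectStar`).

Write `p_n = (I_n ⊗ Δ_*) η^{(n)}` for the components of `K(η)` and `θ_n` for those of `θ_η`. Then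
`(p_0, θ_0) = (Δ_*, -η*)` and `(p_{n+1}, θ_{n+1}) = (I ⊗ p_n)(η, Δ)`, so each pair is built from a
row of that matrix. The matrix of `Θ_η` is lower triangular, with first column `(θ_i)`, and moving
one step down its diagonals applies `I_E ⊗ ·`.

Let `G_{im}` be the matrix entries of `KK* + ΘΘ*`. Normality of the first row gives `G_{00} = I`,
orthogonality of the rows gives `G_{i+1,0} = G_{0,m+1} = 0`, and normality of the second row gives
`G_{i+1,m+1} = I_E ⊗ G_{im}` (`gramEntry_succ_succ`). By induction `G_{im} = δ_{im} I`. Since the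
summands of the Fock space span a dense subspace, the matrix determines the operator. -/

open scoped TensorProduct InnerProductSpace InnerProduct

namespace WStarCorr

/-! ### Algebra of intertwiners -/

namespace Intertwiner

variable {M : Type v} [CStarAlgebra M] {K L N P : HilbertRep.{u} M}

theorem comp_assoc (R : Intertwiner N P) (S : Intertwiner L N) (T : Intertwiner K L) :
    comp (comp R S) T = comp R (comp S T) := rfl

theorem one_comp (T : Intertwiner K L) : comp (one L) T = T := rfl

theorem comp_one (T : Intertwiner K L) : comp T (one K) = T := rfl

theorem add_comp (S S' : Intertwiner L N) (T : Intertwiner K L) :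
    comp (S + S') T = comp S T + comp S' T := Subtype.ext (ContinuousLinearMap.add_comp _ _ _)

theorem comp_add (S : Intertwiner L N) (T T' : Intertwiner K L) :
    comp S (T + T') = comp S T + comp S T' := Subtype.ext (ContinuousLinearMap.comp_add _ _ _)

theorem neg_comp (S : Intertwiner L N) (T : Intertwiner K L) :
    comp (-S) T = -comp S T := Subtype.ext (ContinuousLinearMap.neg_comp _ _)

theorem comp_neg (S : Intertwiner L N) (T : Intertwiner K L) :
    comp S (-T) = -comp S T := Subtype.ext (ContinuousLinearMap.comp_neg _ _)

theorem comp_zero (S : Intertwiner L N) : comp S (0 : Intertwiner K L) = 0 :=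
  Subtype.ext (ContinuousLinearMap.comp_zero _)

theorem adj_comp (S : Intertwiner L N) (T : Intertwiner K L) :
    adj (comp S T) = comp (adj T) (adj S) := Subtype.ext (ContinuousLinearMap.adjoint_comp _ _)

theorem adj_adj (T : Intertwiner K L) : adj (adj T) = T :=
  Subtype.ext (ContinuousLinearMap.adjoint_adjoint _)

theorem adj_neg (T : Intertwiner K L) : adj (-T) = -adj T :=
  Subtype.ext (map_neg ContinuousLinearMap.adjoint T.1)

theorem adj_add (S T : Intertwiner K L) : adj (S + T) = adj S + adj T :=
  Subtype.ext (map_add ContinuousLinearMap.adjoint S.1 T.1)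

theorem adj_zero : adj (0 : Intertwiner K L) = 0 :=
  Subtype.ext (map_zero ContinuousLinearMap.adjoint)

theorem adj_sqrtOneSub (T : Intertwiner K K) : adj (sqrtOneSub T) = sqrtOneSub T :=
  Subtype.ext (IsSelfAdjoint.of_nonneg (CFC.sqrt_nonneg (1 - T.1))).star_eq

/-- The hypothesis `T ≤ 1` is essential: `CFC.sqrt` takes the default value 0 on elements that are
not nonnegative. -/
theorem sqrtOneSub_comp_self {T : Intertwiner K K} (hT : T.1 ≤ 1) :
    comp (sqrtOneSub T) (sqrtOneSub T) + T = one K := by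
  refine Subtype.ext ?_
  have h : CFC.sqrt (1 - T.1) * CFC.sqrt (1 - T.1) = 1 - T.1 :=
    CFC.sqrt_mul_sqrt_self _ (sub_nonneg.2 hT)
  exact eq_sub_iff_add_eq.1 h

end Intertwiner

/-! ### Uniqueness for a Sylvester equation -/

/-- The Sylvester equation `b Z + Z a = 0` with `a, b ≥ 0` and `b` invertible has only the trivial
solution. -/
theorem eq_zero_of_sylvester {H₁ H₂ : Type*} [NormedAddCommGroup H₁] [InnerProductSpace ℂ H₁]
    [CompleteSpace H₁] [NormedAddCommGroup H₂] [InnerProductSpace ℂ H₂] [CompleteSpace H₂]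
    {a : H₁ →L[ℂ] H₁} {b : H₂ →L[ℂ] H₂} {Z : H₁ →L[ℂ] H₂} (ha : 0 ≤ a) (hb : 0 ≤ b)
    (hbu : IsUnit b) (h : b ∘L Z + Z ∘L a = 0) : Z = 0 := by
  have hP : (0 : H₁ →L[ℂ] H₁) ≤ Z† ∘L b ∘L Z :=
    (ContinuousLinearMap.nonneg_iff_isPositive _).2
      (((ContinuousLinearMap.nonneg_iff_isPositive b).1 hb).adjoint_conj Z)
  have hQ : (0 : H₁ →L[ℂ] H₁) ≤ Z† ∘L Z :=
    (ContinuousLinearMap.nonneg_iff_isPositive _).2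
      (ContinuousLinearMap.isPositive_adjoint_comp_self Z)
  -- Multiply the equation by `Z*` from the left.
  have hE : Z† ∘L b ∘L Z = -((Z† ∘L Z) * a) := by
    have := congrArg (fun T => Z† ∘L T) h
    simp only [ContinuousLinearMap.comp_add, ContinuousLinearMap.comp_zero] at this
    exact eq_neg_of_add_eq_zero_left this
  -- The left side of `hE` is self-adjoint, hence so is `(Z*Z) a`. A product of two self-adjoint
  -- operators is self-adjoint only if they commute.
  have hC : Commute (Z† ∘L Z) a := by
    have h1 := (IsSelfAdjoint.of_nonneg hP).star_eq
    rw [hE, star_neg, star_mul, (IsSelfAdjoint.of_nonneg hQ).star_eq,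
      (IsSelfAdjoint.of_nonneg ha).star_eq, neg_inj] at h1
    exact h1.symm
  -- A product of commuting nonnegative operators is nonnegative, so `hE` makes `Z*bZ` both
  -- nonnegative and nonpositive.
  have h0 : Z† ∘L b ∘L Z = 0 :=
    le_antisymm (hE ▸ neg_nonpos.2 (hC.mul_nonneg hQ ha)) hP
  -- With `s² = b` the vanishing of `Z*bZ = (sZ)*(sZ)` forces `sZ = 0`. Then `bZ = 0`, and
  -- invertibility of `b` finishes.
  set s := CFC.sqrt b with hs
  have hss : s * s = b := CFC.sqrt_mul_sqrt_self b hb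
  have hsa : s† = s := (IsSelfAdjoint.of_nonneg (CFC.sqrt_nonneg b)).star_eq
  have h2 : (s ∘L Z)† ∘L (s ∘L Z) = 0 := by
    rw [ContinuousLinearMap.adjoint_comp, hsa, ContinuousLinearMap.comp_assoc,
      ← ContinuousLinearMap.comp_assoc s s Z]
    rw [← hss] at h0
    exact h0
  have h3 : s ∘L Z = 0 := by
    have := ContinuousLinearMap.norm_adjoint_comp_self (s ∘L Z)
    rw [h2, norm_zero] at this
    exact norm_eq_zero.1 (mul_self_eq_zero.1 this.symm)
  have h4 : b ∘L Z = 0 := by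
    rw [← hss]
    change s ∘L (s ∘L Z) = 0
    rw [h3, ContinuousLinearMap.comp_zero]
  obtain ⟨w, rfl⟩ := hbu
  have h5 : ((w⁻¹).1 * w.1) ∘L Z = 0 := by
    change (w⁻¹).1 ∘L (w.1 ∘L Z) = 0
    rw [h4, ContinuousLinearMap.comp_zero]
  rw [w.inv_mul] at h5
  exact h5

namespace WStarCorrespondence

open Intertwiner

variable {M : Type v} [CStarAlgebra M] [PartialOrder M] [StarOrderedRing M]
  {E : Type u} [NormedAddCommGroup E] [NormedSpace ℂ E] [CompleteSpace E] [Module Mᵐᵒᵖ E]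
  (X : WStarCorrespondence M E) {K L N H : HilbertRep.{u} M}

/-! ### Functoriality of `I_E ⊗ ·` -/

theorem amp_ext {S T : Intertwiner (X.tensor K) L}
    (h : ∀ x k, S.1 (X.tmul x k) = T.1 (X.tmul x k)) : S = T :=
  Subtype.ext (X.tensor_ext h)

theorem amp_comp (S : Intertwiner L N) (T : Intertwiner K L) :
    X.amp (comp S T) = comp (X.amp S) (X.amp T) := X.amp_ext fun x k => by
  change _ = (X.amp S).1 ((X.amp T).1 (X.tmul x k))
  rw [amp_tmul, amp_tmul, amp_tmul]; rfl

theorem amp_one : X.amp (one K) = one (X.tensor K) := X.amp_ext fun x k => by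
  rw [amp_tmul]; rfl

theorem amp_add (S T : Intertwiner K L) : X.amp (S + T) = X.amp S + X.amp T :=
  X.amp_ext fun x k => by
    change _ = (X.amp S).1 (X.tmul x k) + (X.amp T).1 (X.tmul x k)
    rw [amp_tmul, amp_tmul, amp_tmul, ← tmul_add_right]; rfl

theorem amp_zero : X.amp (0 : Intertwiner K L) = 0 := X.amp_ext fun x k => by
  rw [amp_tmul]; exact X.tmul_zero_right x

theorem amp_sum {ι : Type*} (s : Finset ι) (T : ι → Intertwiner K L) :
    X.amp (∑ i ∈ s, T i) = ∑ i ∈ s, X.amp (T i) :=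
  map_sum (⟨⟨X.amp, X.amp_zero⟩, X.amp_add⟩ : Intertwiner K L →+ _) T s

/-- On elementary tensors both sides are inner products containing `π(⟨x, y⟩)`. The intertwining
relation moves `T` past this factor, after which the ordinary adjoint applies; density extends the
identity in each variable separately. -/
theorem amp_adj (T : Intertwiner K L) : X.amp (adj T) = adj (X.amp T) := by
  refine Subtype.ext ((ContinuousLinearMap.eq_adjoint_iff _ _).2 fun w z => ?_)
  refine X.tensor_induction
    (p := fun w => ⟪(X.amp (adj T)).1 w, z⟫_ℂ = ⟪w, (X.amp T).1 z⟫_ℂ)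
    (isClosed_eq (by fun_prop) (by fun_prop)) (fun n x h => ?_) w
  refine X.tensor_induction
    (p := fun z => ⟪(X.amp (adj T)).1 (∑ i, X.tmul (x i) (h i)), z⟫_ℂ
      = ⟪∑ i, X.tmul (x i) (h i), (X.amp T).1 z⟫_ℂ)
    (isClosed_eq (by fun_prop) (by fun_prop)) (fun m y k => ?_) z
  simp only [map_sum, sum_inner, inner_sum, amp_tmul, inner_tmul]
  refine Finset.sum_congr rfl fun i _ => Finset.sum_congr rfl fun j _ => ?_
  rw [← apply_rep]
  exact ContinuousLinearMap.adjoint_inner_left T.1 _ _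

/-! ### Defect operators -/

theorem adj_comp_self_le_one (η : X.SigmaDual H) (hη : ‖η‖ < 1) :
    (comp (adj η) η).1 ≤ 1 := by
  have h2 : ‖η.1† ∘L η.1‖ ≤ 1 := by
    rw [ContinuousLinearMap.norm_adjoint_comp_self]
    exact mul_le_one₀ hη.le (norm_nonneg _) hη.le
  refine (IsSelfAdjoint.le_algebraMap_norm_self (a := η.1† ∘L η.1)
    (ContinuousLinearMap.isPositive_adjoint_comp_self η.1).isSelfAdjoint).trans ?_
  rw [← map_one (algebraMap ℝ (H →L[ℂ] H))]
  exact algebraMap_mono _ h2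

theorem comp_adj_self_le_one (η : X.SigmaDual H) (hη : ‖η‖ < 1) :
    (comp η (adj η)).1 ≤ 1 := by
  have h2 : ‖η.1 ∘L η.1†‖ ≤ 1 := by
    have := ContinuousLinearMap.norm_adjoint_comp_self (η.1†)
    rw [ContinuousLinearMap.adjoint_adjoint] at this
    rw [this, LinearIsometryEquiv.norm_map]
    exact mul_le_one₀ hη.le (norm_nonneg _) hη.le
  refine (IsSelfAdjoint.le_algebraMap_norm_self (a := η.1 ∘L η.1†)
    (ContinuousLinearMap.isPositive_self_comp_adjoint η.1).isSelfAdjoint).trans ?_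
  rw [← map_one (algebraMap ℝ (X.tensor H →L[ℂ] X.tensor H))]
  exact algebraMap_mono _ h2

theorem defectStar_sq (η : X.SigmaDual H) (hη : ‖η‖ < 1) :
    comp (X.defectStar η) (X.defectStar η) + comp (adj η) η = one H :=
  sqrtOneSub_comp_self (X.adj_comp_self_le_one η hη)

theorem defect_sq (η : X.SigmaDual H) (hη : ‖η‖ < 1) :
    comp (X.defect η) (X.defect η) + comp η (adj η) = one (X.tensor H) :=
  sqrtOneSub_comp_self (X.comp_adj_self_le_one η hη)

theorem adj_defectStar (η : X.SigmaDual H) : adj (X.defectStar η) = X.defectStar η :=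
  adj_sqrtOneSub _

theorem adj_defect (η : X.SigmaDual H) : adj (X.defect η) = X.defect η :=
  adj_sqrtOneSub _

/-- `η Δ_* = Δ η`. -/
theorem comp_defectStar (η : X.SigmaDual H) (hη : ‖η‖ < 1) :
    comp η (X.defectStar η) = comp (X.defect η) η := by
  refine Subtype.ext (sub_eq_zero.1 ?_)
  -- For `Z = ηΔ_* - Δη` the mixed terms of `ΔZ + ZΔ_*` cancel and leave `ηΔ_*² - Δ²η`. This route
  -- to `Z = 0` needs no polynomial approximation of the square root.
  refine eq_zero_of_sylvester (a := (X.defectStar η).1) (b := (X.defect η).1)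
    (CFC.sqrt_nonneg _) (CFC.sqrt_nonneg _) (X.isUnit_defect η hη) ?_
  have h1 := congrArg (fun T => comp η T) (X.defectStar_sq η hη)
  have h2 := congrArg (fun T => comp T η) (X.defect_sq η hη)
  simp only [comp_add, add_comp, comp_one, one_comp, comp_assoc] at h1 h2
  -- Both `ηΔ_*²` and `Δ²η` become `η` after adding `ηη*η`.
  have h3 := congrArg Subtype.val (add_right_cancel (h1.trans h2.symm))
  rw [ContinuousLinearMap.comp_sub, ContinuousLinearMap.sub_comp]
  have h4 : (η.1 ∘L (X.defectStar η).1) ∘L (X.defectStar η).1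
    = (X.defect η).1 ∘L (X.defect η).1 ∘L η.1 := h3
  have h5 : (X.defect η).1 ∘L (comp η (X.defectStar η)).1
    = (comp (X.defect η) η).1 ∘L (X.defectStar η).1 := rfl
  rw [h5]
  change _ - (X.defect η).1 ∘L (X.defect η).1 ∘L η.1
    + ((η.1 ∘L (X.defectStar η).1) ∘L (X.defectStar η).1 - _) = 0
  rw [h4]
  abel

/-! ### Recursions for the components of `K(η)` and `θ_η` -/

/-- The definition splits off the factor `η` applied last; here the one applied first is split off.
This puts `I_E ⊗ ·` outermost, matching the shift in the matrix of `Θ_η`. -/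
theorem dualPow_succ' (η : X.SigmaDual H) (n : ℕ) :
    X.dualPow η (n + 1) = comp (X.amp (X.dualPow η n)) η := by
  induction n with
  | zero =>
    change η = comp (X.amp (one H)) η
    rw [amp_one]; rfl
  | succ n ih =>
    change comp (X.amp (X.ampDual η n)) (X.dualPow η (n + 1)) = _
    rw [ih, ← comp_assoc, ← amp_comp, ← ih]; rfl

/-- The component `(I_n ⊗ Δ_*) η^{(n)}` of the Poisson kernel. -/
noncomputable def poissonCoord (η : X.SigmaDual H) (n : ℕ) : Intertwiner H (X.tensorPow H n) :=
  comp (X.ampPow (X.defectStar η) n) (X.dualPow η n)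

theorem poissonCoord_succ (η : X.SigmaDual H) (n : ℕ) :
    X.poissonCoord η (n + 1) = comp (X.amp (X.poissonCoord η n)) η := by
  unfold poissonCoord
  rw [dualPow_succ', amp_comp]; rfl

/-- Together with `poissonCoord_succ` this exhibits the common left factor `I ⊗ p_n` of `p_{n+1}`
and `θ_{n+1}`, leaving the row `(η, Δ)`. -/
theorem theta_succ (η : X.SigmaDual H) (n : ℕ) :
    X.theta η (n + 1) = comp (X.amp (X.poissonCoord η n)) (X.defect η) := by
  unfold poissonCoord
  rw [amp_comp]; rfl

theorem entry_eq_zero (η : X.SigmaDual H) : ∀ {i j : ℕ}, i < j → X.entry η i j = 0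
  | 0, _ + 1, _ => rfl
  | i + 1, j + 1, h => by
    change X.amp (X.entry η i j) = 0
    rw [entry_eq_zero η (Nat.lt_of_succ_lt_succ h), amp_zero]

/-- Orthogonality of the rows `(η, Δ)` and `(Δ_*, -η*)`: the sum is `A(ηΔ_* - Δη)`. -/
theorem comp_defect_column (η : X.SigmaDual H) (hη : ‖η‖ < 1) (A : Intertwiner (X.tensor H) L) :
    comp (comp A η) (adj (X.defectStar η)) + comp (comp A (X.defect η)) (adj (-adj η)) = 0 := by
  rw [adj_defectStar, adj_neg, adj_adj, comp_assoc, comp_defectStar X η hη, comp_neg, comp_assoc,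
    add_neg_cancel]

/-- The row `(η, Δ)` is a coisometry, so `ηη* + Δ² = I` disappears between `A` and `B*`. -/
theorem comp_defect_gram (η : X.SigmaDual H) (hη : ‖η‖ < 1) (A : Intertwiner (X.tensor H) L)
    (B : Intertwiner (X.tensor H) N) :
    comp (comp A η) (adj (comp B η)) + comp (comp A (X.defect η)) (adj (comp B (X.defect η)))
      = comp A (adj B) := by
  rw [adj_comp, adj_comp, adj_defect, comp_assoc, comp_assoc, ← comp_add, ← comp_assoc,
    ← comp_assoc (X.defect η), ← add_comp, add_comm, defect_sq X η hη, one_comp]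

/-! ### The matrix of `K(η)K(η)* + Θ_η Θ_η*` -/

/-- The `(i, m)` matrix entry of `K(η) K(η)* + Θ_η Θ_η*`. -/
noncomputable def gramEntry (η : X.SigmaDual H) (i m : ℕ) :
    Intertwiner (X.tensorPow H m) (X.tensorPow H i) :=
  comp (X.poissonCoord η i) (adj (X.poissonCoord η m))
    + ∑ j ∈ Finset.range (i + 1), comp (X.entry η i j) (adj (X.entry η m j))

theorem gramEntry_zero_zero (η : X.SigmaDual H) (hη : ‖η‖ < 1) :
    X.gramEntry η 0 0 = one H := by
  rw [gramEntry, Finset.sum_range_one]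
  change comp (X.defectStar η) (adj (X.defectStar η)) + comp (-adj η) (adj (-adj η)) = _
  rw [adj_neg, adj_adj, adj_defectStar, neg_comp, comp_neg, neg_neg, defectStar_sq X η hη]

/-- Row 0 of `Θ_η` has the single nonzero entry `θ_0 = -η*`, so only the term `j = 0` survives, and
row orthogonality cancels it against the Poisson term. -/
theorem gramEntry_succ_zero (η : X.SigmaDual H) (hη : ‖η‖ < 1) (i : ℕ) :
    X.gramEntry η (i + 1) 0 = 0 := by
  rw [gramEntry, Finset.sum_range_succ', Finset.sum_eq_zero, zero_add, entry_zero, entry_zero,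
    theta_succ, poissonCoord_succ]
  · exact X.comp_defect_column η hη (X.amp (X.poissonCoord η i))
  · intro j _
    rw [X.entry_eq_zero η (Nat.succ_pos j), adj_zero, comp_zero]

theorem gramEntry_zero_succ (η : X.SigmaDual H) (hη : ‖η‖ < 1) (m : ℕ) :
    X.gramEntry η 0 (m + 1) = 0 := by
  -- The sum runs over `j ≤ 0` only, so the entry is the adjoint of the expression already known to
  -- vanish.
  have h := congrArg adj (X.comp_defect_column η hη (X.amp (X.poissonCoord η m)))
  rw [adj_add, adj_comp (comp _ η), adj_comp (comp _ (X.defect η)), adj_adj, adj_adj, adj_zero] at h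
  rw [gramEntry, Finset.sum_range_one, entry_zero, entry_zero, theta_succ, poissonCoord_succ]
  exact h

/-- The Poisson term and the column `j = 0` merge, by the coisometry relation, into `I ⊗ p_i p_m*`;
the columns `j + 1` are the shifted columns `j`. Together they are `I ⊗ G_{im}`. -/
theorem gramEntry_succ_succ (η : X.SigmaDual H) (hη : ‖η‖ < 1) (i m : ℕ) :
    X.gramEntry η (i + 1) (m + 1) = X.amp (X.gramEntry η i m) := by
  have h1 : ∀ j, comp (X.entry η (i + 1) (j + 1)) (adj (X.entry η (m + 1) (j + 1)))
      = X.amp (comp (X.entry η i j) (adj (X.entry η m j))) := fun j => by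
    rw [amp_comp, amp_adj]; rfl
  have h2 : comp (X.poissonCoord η (i + 1)) (adj (X.poissonCoord η (m + 1)))
      + comp (X.theta η (i + 1)) (adj (X.theta η (m + 1)))
      = X.amp (comp (X.poissonCoord η i) (adj (X.poissonCoord η m))) := by
    rw [theta_succ, theta_succ, poissonCoord_succ, poissonCoord_succ, amp_comp, amp_adj]
    exact X.comp_defect_gram η hη (X.amp (X.poissonCoord η i)) (X.amp (X.poissonCoord η m))
  rw [gramEntry, Finset.sum_range_succ', entry_zero, entry_zero, add_comm (Finset.sum _ _),
    ← add_assoc, gramEntry, amp_add, amp_sum]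
  exact congrArg₂ (· + ·) h2 (Finset.sum_congr rfl fun j _ => h1 j)

theorem gramEntry_self (η : X.SigmaDual H) (hη : ‖η‖ < 1) :
    ∀ i, X.gramEntry η i i = one (X.tensorPow H i)
  | 0 => X.gramEntry_zero_zero η hη
  | i + 1 => by
    rw [X.gramEntry_succ_succ η hη, gramEntry_self η hη i, amp_one]; rfl

theorem gramEntry_of_ne (η : X.SigmaDual H) (hη : ‖η‖ < 1) :
    ∀ {i m : ℕ}, i ≠ m → X.gramEntry η i m = 0
  | 0, 0, h => absurd rfl h
  | i + 1, 0, _ => X.gramEntry_succ_zero η hη i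
  | 0, m + 1, _ => X.gramEntry_zero_succ η hη m
  | i + 1, m + 1, h => by
    rw [X.gramEntry_succ_succ η hη, gramEntry_of_ne η hη fun e => h (congrArg _ e), amp_zero]; rfl

/-! ### From matrix entries to operators -/

theorem inner_incl_left (n : ℕ) (k : X.tensorPow K n) (x : X.Fock K) :
    ⟪X.incl n k, x⟫_ℂ = ⟪k, X.coord x n⟫_ℂ :=
  lp.inner_single_left (𝕜 := ℂ) (G := fun n => (X.tensorPow K n : Type u)) n k x

theorem inner_incl_right (n : ℕ) (k : X.tensorPow K n) (x : X.Fock K) :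
    ⟪x, X.incl n k⟫_ℂ = ⟪X.coord x n, k⟫_ℂ :=
  lp.inner_single_right (𝕜 := ℂ) (G := fun n => (X.tensorPow K n : Type u)) n k x

theorem adjoint_poissonKernel_incl (η : X.SigmaDual H) (hη : ‖η‖ < 1) (m : ℕ)
    (y : X.tensorPow H m) :
    ((X.poissonKernel η hη)†) (X.incl m y) = (adj (X.poissonCoord η m)).1 y := by
  refine ext_inner_left ℂ fun h => ?_
  rw [ContinuousLinearMap.adjoint_inner_right, inner_incl_right]
  exact (ContinuousLinearMap.adjoint_inner_right (X.poissonCoord η m).1 h y).symm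

theorem characteristicOperator_incl_coord (η : X.SigmaDual H) (hη : ‖η‖ < 1) (j m : ℕ)
    (z : X.tensorPow (X.tensor H) j) :
    X.coord (X.characteristicOperator η hη (X.incl j z)) m = (X.entry η m j).1 z := by
  rw [characteristicOperator_coord, Finset.sum_eq_single j, incl_self]
  · intro l _ hl
    rw [X.incl_ne z hl, map_zero]
  -- If `j > m` the index `j` lies outside the finite sum, and the claimed value is 0 by
  -- triangularity.
  · intro hj
    rw [Finset.mem_range, not_lt] at hj
    rw [X.entry_eq_zero η (Nat.lt_of_succ_le hj)]; rfl

theorem adjoint_characteristicOperator_incl_coord (η : X.SigmaDual H) (hη : ‖η‖ < 1) (m j : ℕ)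
    (y : X.tensorPow H m) :
    X.coord (((X.characteristicOperator η hη)†) (X.incl m y)) j = (adj (X.entry η m j)).1 y := by
  refine ext_inner_left ℂ fun z => ?_
  rw [← inner_incl_left, ContinuousLinearMap.adjoint_inner_right, inner_incl_right,
    characteristicOperator_incl_coord]
  exact (ContinuousLinearMap.adjoint_inner_right (X.entry η m j).1 z y).symm

/-- Every vector is the norm-convergent sum of its components, so continuity reduces equality to the
summands. -/
theorem fock_clm_ext {P : Type*} [NormedAddCommGroup P] [NormedSpace ℂ P]
    {S T : X.Fock K →L[ℂ] P} (h : ∀ n k, S (X.incl n k) = T (X.incl n k)) : S = T := by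
  refine ContinuousLinearMap.ext fun x => ((X.hasSum_incl x).mapL S).unique ?_
  simpa only [h] using (X.hasSum_incl x).mapL T

/-- Triangularity keeps this free of infinite series: coordinate `i` of `Θ_η x` involves only the
components of `x` with `j ≤ i`, which is the range of summation in `gramEntry`. -/
theorem coord_gram_incl (η : X.SigmaDual H) (hη : ‖η‖ < 1) (i m : ℕ) (y : X.tensorPow H m) :
    X.coord ((X.poissonKernel η hη ∘L (X.poissonKernel η hη)†
      + X.characteristicOperator η hη ∘L (X.characteristicOperator η hη)†) (X.incl m y)) i
      = (X.gramEntry η i m).1 y := by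
  change X.coord (X.poissonKernel η hη (((X.poissonKernel η hη)†) (X.incl m y))) i
    + X.coord (X.characteristicOperator η hη
        (((X.characteristicOperator η hη)†) (X.incl m y))) i = _
  rw [adjoint_poissonKernel_incl, characteristicOperator_coord]
  simp only [adjoint_characteristicOperator_incl_coord]
  rw [gramEntry, Submodule.coe_add, Submodule.coe_sum, add_apply, sum_apply]
  rfl

end WStarCorrespondence
end WStarCorr

theorem theorem4p2
    {M : Type v} [CStarAlgebra M] [PartialOrder M] [StarOrderedRing M] [WStarAlgebra M]
    {E : Type u} [NormedAddCommGroup E] [NormedSpace ℂ E] [CompleteSpace E] [Module Mᵐᵒᵖ E]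
    (X : WStarCorr.WStarCorrespondence M E)
    (H : WStarCorr.HilbertRep.{u} M) (hH : H.IsNormal)
    (η : X.SigmaDual H) (hη : ‖η‖ < 1) :
    (1 : X.Fock H →L[ℂ] X.Fock H)
      = X.poissonKernel η hη ∘L ContinuousLinearMap.adjoint (X.poissonKernel η hη)
        + X.characteristicOperator η hη ∘L
          ContinuousLinearMap.adjoint (X.characteristicOperator η hη) := by
  symm
  refine X.fock_clm_ext fun m y => WStarCorr.WStarCorrespondence.fock_ext fun i => ?_
  rw [X.coord_gram_incl η hη]
  change _ = X.coord (X.incl m y) i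
  -- What remains is `G_{im} = δ_{im} I`.
  by_cases h : i = m
  · subst h
    rw [X.gramEntry_self η hη, X.incl_self]; rfl
  · rw [X.gramEntry_of_ne η hη h, X.incl_ne y h]; rfl
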